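/- **Model.** Let $d,K,T\ge 1$. In each round $t=1,\dots,T$ the learner sees contexts $x_{t,1},\dots,x_{t,K}\in\mathbb R^d$ (a fixed, time-varying sequence), plays an arm $A_t\in[K]$ and receives $Y_t=\langle\theta^*,X_t\rangle+\eta_{t,A_t}$, where $X_t=x_{t,A_t}$ and $\theta^*\in\mathbb R^d$ is unknown. The noise vectors $(\eta_{t,a})_{a\in[K]}$ are independent over $t$, and each $\eta_{t,a}$ is $R$-sub-Gaussian, $\mathbb E\,e^{\lambda\eta_{t,a}}\le e^{\lambda^2R^2/2}$ for all $\lambda\in\mathbb R$, with $R\le\frac12$ (as holds with $R=\frac12$ for rewards in $[0,1]$). Assume $\|x_{t,a}\|\le L=1$, $\|\theta^*\|\le S=1$ and $\Delta_{t,b}:=\max_a\langle\theta^*,x_{t,a}\rangle-\langle\theta^*,x_{t,b}\rangle\le 1$ for all $t,a,b$. The expected regret is $R_T=\mathbb E\sum_{t=1}^T\Delta_{t,A_t}$. **SupLinIMED.** Put $\gamma_t=\frac1{2t^2}$, $\alpha_t=\sqrt{\frac12\ln\frac{2TK}{\gamma_t}}$ and $\Psi_1^s=\emptyset$ for all phases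 $s\ge 1$. In round $t$, for each phase $s$, let $V=I+\sum_{\tau\in\Psi_t^s}X_\tau X_\tau^\top$, $\hat\theta=V^{-1}\sum_{\tau\in\Psi_t^s}Y_\tau X_\tau$, $w^s_{t,a}=\alpha_t\sqrt{x_{t,a}^\top V^{-1}x_{t,a}}$ and $\hat Y^s_{t,a}=\langle\hat\theta,x_{t,a}\rangle$. Start with $s=1$, $\hat{\mathcal A}_1=[K]$, and repeat until an arm is chosen: 1. If $w^s_{t,a}\le 1/\sqrt T$ for all $a\in\hat{\mathcal A}_s$, choose $A_t\in\arg\min_{a\in\hat{\mathcal A}_s}I_{t,a}$, where, with $\hat a\in\arg\max_{b\in\hat{\mathcal A}_s}\hat Y^s_{t,b}$, $I_{t,\hat a}=\log(2T)\wedge(-\log((w^s_{t,\hat a})^2))$ and $I_{t,a}=\big((\hat Y^s_{t,\hat a}-\hat Y^s_{t,a})/w^s_{t,a}\big)^2-\log((w^s_{t,a})^2)$ for $a\ne\hat a$ (with $-\log 0=+\infty$, and $I_{t,a}=+\infty$ if $a\neq\hat a$ and $w^s_{t,a}=0$); ties are broken arbitrarily. All index sets are kept, $\Psi^{s'}_{t+1}=\Psi^{s'}_t$.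 2. Otherwise, if $w^s_{t,a}\le 2^{-s}$ for all $a\in\hat{\mathcal A}_s$, put $\hat{\mathcal A}_{s+1}=\{a\in\hat{\mathcal A}_s:\hat Y^s_{t,a}+w^s_{t,a}\ge\max_{b\in\hat{\mathcal A}_s}(\hat Y^s_{t,b}+w^s_{t,b})-2^{1-s}\}$ and increase $s$ by $1$. 3. Otherwise choose some $A_t\in\hat{\mathcal A}_s$ with $w^s_{t,A_t}>2^{-s}$, by any fixed rule that depends on $t$, $s$, the widths $(w^s_{t,a})_a$ and the set of such arms; put $\Psi^s_{t+1}=\Psi^s_t\cup\{t\}$ and keep the other index sets. (The loop always ends with $s\le\max(1,\lceil\log T\rceil)$.) **Theorem.** There is a universal constant $C>0$ such that for all $d,K,T$ and all problem instances as above, $$R_T\le C\sqrt{d\,T\log^3(KT)}.$$ -/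

import Mathlib

open MeasureTheory ProbabilityTheory
open scoped NNReal Matrix

noncomputable section

namespace SupLinIMED

/-! Rounds are numbered `1, …, T` and phases `1, 2, …`; values at index `0` are never used.
The arms are `Fin K`, and `x t a` is the context of arm `a` in round `t`. -/

/-- The confidence parameter of round `t`. -/
def gamma (t : ℕ) : ℝ := 1 / (2 * (t : ℝ) ^ 2)

/-- The width multiplier of round `t`. -/
def alpha (T K t : ℕ) : ℝ := √(1 / 2 * Real.log (2 * T * K / gamma t))

/-! ### The ridge regression subroutine

`X τ` is the context of the arm played in round `τ` and `Y τ` the reward received there; only the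
rounds in `Ψ` are used. -/

/-- `V = I + ∑_{τ ∈ Ψ} X_τ X_τᵀ`. -/
def gram {d : ℕ} (X : ℕ → EuclideanSpace ℝ (Fin d)) (Ψ : Finset ℕ) :
    Matrix (Fin d) (Fin d) ℝ :=
  1 + ∑ τ ∈ Ψ, Matrix.vecMulVec (X τ).ofLp (X τ).ofLp

/-- `θ̂ = V⁻¹ ∑_{τ ∈ Ψ} Y_τ X_τ`. -/
def thetaHat {d : ℕ} (X : ℕ → EuclideanSpace ℝ (Fin d)) (Y : ℕ → ℝ) (Ψ : Finset ℕ) :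
    EuclideanSpace ℝ (Fin d) :=
  WithLp.toLp 2 ((gram X Ψ)⁻¹ *ᵥ (∑ τ ∈ Ψ, Y τ • X τ).ofLp)

/-- The width `α √(vᵀ V⁻¹ v)` of a context `v` in round `t`. -/
def width {d : ℕ} (T K t : ℕ) (X : ℕ → EuclideanSpace ℝ (Fin d)) (Ψ : Finset ℕ)
    (v : EuclideanSpace ℝ (Fin d)) : ℝ :=
  alpha T K t * √(v.ofLp ⬝ᵥ ((gram X Ψ)⁻¹ *ᵥ v.ofLp))

/-- The sample mean `⟨θ̂, v⟩` of a context `v`. -/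
def sampleMean {d : ℕ} (X : ℕ → EuclideanSpace ℝ (Fin d)) (Y : ℕ → ℝ) (Ψ : Finset ℕ)
    (v : EuclideanSpace ℝ (Fin d)) : ℝ :=
  inner ℝ (thetaHat X Y Ψ) v

/-! ### The phases of one round

`w s a` and `y s a` are the width and the sample mean of arm `a` in phase `s`. -/

open Classical in
/-- The set of arms that are still alive in phase `s`: all of them in phase `1`; from phase `s` to
phase `s + 1` those arms are kept whose `y + w` is at least the maximum of `y + w` minus
`2 ^ (1 - s)`. -/
def candidates {K : ℕ} (w y : ℕ → Fin K → ℝ) : ℕ → Finset (Fin K)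
  | 0 => Finset.univ
  | 1 => Finset.univ
  | s + 2 => (candidates w y (s + 1)).filter fun a =>
      ∀ b ∈ candidates w y (s + 1),
        y (s + 1) b + w (s + 1) b - (2 : ℝ) ^ (1 - ((s + 1 : ℕ) : ℤ)) ≤ y (s + 1) a + w (s + 1) a

/-- All widths of phase `s` are at most `1 / √T`: the arm is chosen by its index. -/
def AllTiny {K : ℕ} (T : ℕ) (w y : ℕ → Fin K → ℝ) (s : ℕ) : Prop :=
  ∀ a ∈ candidates w y s, w s a ≤ 1 / √(T : ℝ)

/-- All widths of phase `s` are at most `2 ^ (-s)`. -/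
def AllSmall {K : ℕ} (w y : ℕ → Fin K → ℝ) (s : ℕ) : Prop :=
  ∀ a ∈ candidates w y s, w s a ≤ (2 : ℝ) ^ (-(s : ℤ))

/-- Phase `s` chooses no arm, it eliminates arms and hands over to phase `s + 1`. -/
def Advances {K : ℕ} (T : ℕ) (w y : ℕ → Fin K → ℝ) (s : ℕ) : Prop :=
  ¬ AllTiny T w y s ∧ AllSmall w y s

/-- The phase in which the arm of the round is chosen. -/
def phase {K : ℕ} (T : ℕ) (w y : ℕ → Fin K → ℝ) : ℕ :=
  sInf {s | 1 ≤ s ∧ ¬ Advances T w y s}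

/-- The loop over the phases always ends, within the allotted `⌈log T⌉` phases. -/
theorem phase_spec {K : ℕ} (T : ℕ) (hT : 1 ≤ T) (w y : ℕ → Fin K → ℝ) :
    1 ≤ phase T w y ∧ ¬ Advances T w y (phase T w y) ∧
      phase T w y ≤ max 1 ⌈Real.log T⌉₊ := by
  have hT0 : (0 : ℝ) < T := by exact_mod_cast hT
  have key : max 1 ⌈Real.log T⌉₊ ∈ {s | 1 ≤ s ∧ ¬ Advances T w y s} := by
    refine ⟨le_max_left _ _, fun h => h.1 fun a ha => (h.2 a ha).trans ?_⟩
    set s := max 1 ⌈Real.log T⌉₊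
    have hs : Real.log T ≤ s := (Nat.le_ceil _).trans (by exact_mod_cast le_max_right _ _)
    have h2 : √(T : ℝ) ≤ (2 : ℝ) ^ s := by
      rw [Real.sqrt_le_left (by positivity), ← Real.log_le_log_iff hT0 (by positivity),
        Real.log_pow, Real.log_pow]
      have := Real.log_two_gt_d9
      push_cast
      nlinarith [(Nat.cast_nonneg s : (0 : ℝ) ≤ s)]
    rw [zpow_neg, zpow_natCast, ← one_div]
    exact one_div_le_one_div_of_le (Real.sqrt_pos.2 hT0) h2
  have hmem := Nat.sInf_mem (⟨_, key⟩ : {s | 1 ≤ s ∧ ¬ Advances T w y s}.Nonempty)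
  exact ⟨hmem.1, hmem.2, Nat.sInf_le key⟩

/-- `-log (w ^ 2)`, with the value `+∞` at `w = 0`. -/
def negLogSq (w : ℝ) : EReal :=
  if w = 0 then ⊤ else ((-Real.log (w ^ 2) : ℝ) : EReal)

open Classical in
/-- The index of arm `a` for widths `w`, sample means `y` and empirically best arm `best`. An arm
of width `0` other than `best` has index `+∞`. -/
def armIndex {K : ℕ} (T : ℕ) (w y : Fin K → ℝ) (best a : Fin K) : EReal :=
  if a = best then min ((Real.log (2 * T) : ℝ) : EReal) (negLogSq (w a))
  else ((((y best - y a) / w a) ^ 2 : ℝ) : EReal) + negLogSq (w a)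

/-! ### The algorithm

`A t` is the arm played and `Y t` the reward received in round `t`. -/

/-- The widths of round `t` in all phases when the index sets are `Ψ`. -/
def widths {d K : ℕ} (T : ℕ) (x : ℕ → Fin K → EuclideanSpace ℝ (Fin d)) (A : ℕ → Fin K)
    (t : ℕ) (Ψ : ℕ → Finset ℕ) (s : ℕ) (a : Fin K) : ℝ :=
  width T K t (fun τ => x τ (A τ)) (Ψ s) (x t a)

/-- The sample means of round `t` in all phases when the index sets are `Ψ`. -/
def sampleMeans {d K : ℕ} (x : ℕ → Fin K → EuclideanSpace ℝ (Fin d)) (A : ℕ → Fin K)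
    (Y : ℕ → ℝ) (t : ℕ) (Ψ : ℕ → Finset ℕ) (s : ℕ) (a : Fin K) : ℝ :=
  sampleMean (fun τ => x τ (A τ)) Y (Ψ s) (x t a)

open Classical in
/-- The index sets `Ψ_t^s ⊆ {1, …, t - 1}` at the start of round `t`. Round `t` is added to the
set of its phase if the arm is chosen there because of a width above `2 ^ (-s)`, and to no set if
the arm is chosen by its index. -/
def indexSets {d K : ℕ} (T : ℕ) (x : ℕ → Fin K → EuclideanSpace ℝ (Fin d)) (A : ℕ → Fin K)
    (Y : ℕ → ℝ) : ℕ → ℕ → Finset ℕ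
  | 0 => fun _ => ∅
  | t + 1 => fun s =>
      let Ψ := indexSets T x A Y t
      let w := widths T x A t Ψ
      let y := sampleMeans x A Y t Ψ
      if 1 ≤ t ∧ s = phase T w y ∧ ¬ AllTiny T w y s then insert t (Ψ s) else Ψ s

open Classical in
/-- The arms of the run follow the algorithm in rounds `1, …, T`. If all widths of the final phase
are at most `1 / √T`, the arm minimizes the index among the arms alive; the ties in the two
extremal choices are broken arbitrarily. Otherwise the arm is one of those with width above
`2 ^ (-s)`; which of them is prescribed by the rule `ρ`, as a function of the round, the phase, the
widths in that phase and the set of these arms. -/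
def Follows {d K : ℕ} (T : ℕ) (x : ℕ → Fin K → EuclideanSpace ℝ (Fin d))
    (ρ : ℕ → ℕ → (Fin K → ℝ) → Finset (Fin K) → Fin K) (A : ℕ → Fin K) (Y : ℕ → ℝ) : Prop :=
  ∀ t ∈ Finset.Icc 1 T,
    let w := widths T x A t (indexSets T x A Y t)
    let y := sampleMeans x A Y t (indexSets T x A Y t)
    let s := phase T w y
    (AllTiny T w y s →
      ∃ best ∈ candidates w y s, (∀ b ∈ candidates w y s, y s b ≤ y s best) ∧
        A t ∈ candidates w y s ∧
        ∀ b ∈ candidates w y s,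
          armIndex T (w s) (y s) best (A t) ≤ armIndex T (w s) (y s) best b) ∧
    (¬ AllTiny T w y s →
      A t = ρ t s (w s) ((candidates w y s).filter fun a => (2 : ℝ) ^ (-(s : ℤ)) < w s a))

/-- The gap `Δ_{t,b} = max_a ⟨θ, x_{t,a}⟩ - ⟨θ, x_{t,b}⟩`. -/
def gap {d K : ℕ} (x : ℕ → Fin K → EuclideanSpace ℝ (Fin d)) (θ : EuclideanSpace ℝ (Fin d))
    (t : ℕ) (b : Fin K) : ℝ :=
  (⨆ a, inner ℝ θ (x t a)) - inner ℝ θ (x t b)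

end SupLinIMED

end

/-! Ridge regression on a design that does not look at its own rewards has error at most the width,
outside an event of small probability. With `u = V⁻¹ v` the error is the noise form `∑ ⟨X_τ, u⟩ η_τ`
minus the bias `⟨θ, u⟩`, and `vᵀ V⁻¹ v = ‖u‖² + ∑ ⟨X_τ, u⟩²` controls both terms at once
(`measure_width_lt_error_le`).

The phases supply the missing independence. Whether a round joins `Ψ^s`, and with which arm, depends
only on widths up to phase `s` and on sample means of phases before `s`. Fix the record of all
width-driven choices up to phase `s`. This event is measurable in the noise of the rounds of earlier
phases (`measurableSet_history`). On it the design of phase `s` is deterministic, and the noise in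
that design is independent of the event. Summing over the countably many records gives the
unconditional tail (`measure_not_confident_arm_le`). Arms chosen by index may depend on anything,
since their rounds enter no index set.

When all intervals of a round hold, a best arm survives every elimination. An arm explored in phase
`s` then loses at most `8 * 2 ^ (-s)`, less than eight times its width, and an arm chosen by index
loses at most `3 / √T` (`gap_le_of_confident`). Cauchy–Schwarz and the elliptical potential, summed
over `O(log T)` phases, bound the total width by `α_T √(d T log² (KT))` up to a constant, and `α_T`
contributes the third logarithm under the root (`sum_gap_le`). A round with a failing interval costs
at most `1` and has probability `O(log T / T)`, so these rounds add `O(log T)`. -/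

noncomputable section

namespace SupLinIMED

/-! ### Ridge regression: linear algebra -/

section LinearAlgebra

variable {d : ℕ} (X : ℕ → EuclideanSpace ℝ (Fin d)) (Ψ : Finset ℕ)

/-- The weight vector `V⁻¹ v`, which represents the sample mean at `v` as a linear functional of
the rewards. -/
def weightVector (v : EuclideanSpace ℝ (Fin d)) : EuclideanSpace ℝ (Fin d) :=
  WithLp.toLp 2 ((gram X Ψ)⁻¹ *ᵥ v.ofLp)

/-- The squared `V⁻¹`-norm `vᵀ V⁻¹ v`. -/
def leverage (v : EuclideanSpace ℝ (Fin d)) : ℝ :=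
  v.ofLp ⬝ᵥ ((gram X Ψ)⁻¹ *ᵥ v.ofLp)

theorem inner_eq_dotProduct (u v : EuclideanSpace ℝ (Fin d)) :
    inner ℝ u v = u.ofLp ⬝ᵥ v.ofLp := by
  rw [EuclideanSpace.inner_eq_star_dotProduct, star_trivial, dotProduct_comm]

theorem gram_posDef : (gram X Ψ).PosDef := by
  refine Matrix.PosDef.one.add_posSemidef (Matrix.posSemidef_sum _ fun τ _ => ?_)
  simpa using Matrix.posSemidef_vecMulVec_self_star (X τ).ofLp

theorem isUnit_det_gram : IsUnit (gram X Ψ).det :=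
  (gram_posDef X Ψ).det_pos.ne'.isUnit

theorem gram_mulVec (u : EuclideanSpace ℝ (Fin d)) :
    WithLp.toLp 2 (gram X Ψ *ᵥ u.ofLp) = u + ∑ τ ∈ Ψ, inner ℝ (X τ) u • X τ := by
  ext i
  simp only [gram, Matrix.add_mulVec, Matrix.one_mulVec, Matrix.sum_mulVec,
    Matrix.vecMulVec_mulVec, inner_eq_dotProduct]
  simp

theorem eq_weightVector_add_sum (v : EuclideanSpace ℝ (Fin d)) :
    v = weightVector X Ψ v + ∑ τ ∈ Ψ, inner ℝ (X τ) (weightVector X Ψ v) • X τ := by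
  rw [← gram_mulVec]
  simp [weightVector, Matrix.mulVec_mulVec, Matrix.mul_nonsing_inv _ (isUnit_det_gram X Ψ)]

theorem inner_eq_add_sum (θ v : EuclideanSpace ℝ (Fin d)) :
    inner ℝ θ v = inner ℝ θ (weightVector X Ψ v) +
      ∑ τ ∈ Ψ, inner ℝ θ (X τ) * inner ℝ (X τ) (weightVector X Ψ v) := by
  conv_lhs => rw [eq_weightVector_add_sum X Ψ v]
  rw [inner_add_right, inner_sum]
  simp only [inner_smul_right]
  congr 1
  exact Finset.sum_congr rfl fun τ _ => mul_comm _ _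

theorem leverage_eq_inner (v : EuclideanSpace ℝ (Fin d)) :
    leverage X Ψ v = inner ℝ (weightVector X Ψ v) v := by
  rw [real_inner_comm, inner_eq_dotProduct]; rfl

/-- Pair `v = V u` with `u = V⁻¹ v`. The first term will pay for the regularization bias, the second
for the variance of the noise. -/
theorem leverage_eq (v : EuclideanSpace ℝ (Fin d)) :
    leverage X Ψ v = ‖weightVector X Ψ v‖ ^ 2 +
      ∑ τ ∈ Ψ, inner ℝ (X τ) (weightVector X Ψ v) ^ 2 := by
  rw [leverage_eq_inner, inner_eq_add_sum X Ψ, real_inner_self_eq_norm_sq]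
  congr 1
  refine Finset.sum_congr rfl fun τ _ => ?_
  rw [real_inner_comm, sq]

theorem norm_weightVector_sq_le (v : EuclideanSpace ℝ (Fin d)) :
    ‖weightVector X Ψ v‖ ^ 2 ≤ leverage X Ψ v := by
  rw [leverage_eq]
  have : 0 ≤ ∑ τ ∈ Ψ, inner ℝ (X τ) (weightVector X Ψ v) ^ 2 :=
    Finset.sum_nonneg fun _ _ => sq_nonneg _
  linarith

theorem leverage_nonneg (v : EuclideanSpace ℝ (Fin d)) : 0 ≤ leverage X Ψ v :=
  (sq_nonneg _).trans (norm_weightVector_sq_le X Ψ v)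

/-- With `u = V⁻¹ v`, `‖u‖² ≤ leverage ≤ ‖u‖` forces `‖u‖ ≤ 1`. -/
theorem leverage_le_one {v : EuclideanSpace ℝ (Fin d)} (hv : ‖v‖ ≤ 1) : leverage X Ψ v ≤ 1 := by
  have h1 := norm_weightVector_sq_le X Ψ v
  have h2 : leverage X Ψ v ≤ ‖weightVector X Ψ v‖ * ‖v‖ := by
    rw [leverage_eq_inner]; exact real_inner_le_norm _ _
  have h3 := h2.trans (mul_le_of_le_one_right (norm_nonneg _) hv)
  nlinarith [norm_nonneg (weightVector X Ψ v)]

theorem sampleMean_eq (Y : ℕ → ℝ) (v : EuclideanSpace ℝ (Fin d)) :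
    sampleMean X Y Ψ v = ∑ τ ∈ Ψ, Y τ * inner ℝ (X τ) (weightVector X Ψ v) := by
  have hsymm : ((gram X Ψ)⁻¹)ᵀ = (gram X Ψ)⁻¹ := by
    rw [← Matrix.conjTranspose_eq_transpose_of_trivial]
    exact (gram_posDef X Ψ).inv.isHermitian.eq
  have : sampleMean X Y Ψ v = inner ℝ (∑ τ ∈ Ψ, Y τ • X τ) (weightVector X Ψ v) := by
    rw [sampleMean, inner_eq_dotProduct, inner_eq_dotProduct, thetaHat, weightVector]
    simp only
    rw [Matrix.dotProduct_mulVec, ← Matrix.mulVec_transpose, hsymm]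
  rw [this, sum_inner]
  simp [inner_smul_left]

/-- The error of ridge regression splits into a bias and a linear form in the noise. -/
theorem sampleMean_sub_inner (θ v : EuclideanSpace ℝ (Fin d)) (e : ℕ → ℝ) :
    sampleMean X (fun τ => inner ℝ θ (X τ) + e τ) Ψ v - inner ℝ θ v =
      ∑ τ ∈ Ψ, inner ℝ (X τ) (weightVector X Ψ v) * e τ - inner ℝ θ (weightVector X Ψ v) := by
  rw [sampleMean_eq, inner_eq_add_sum X Ψ θ v]
  simp only [add_mul, Finset.sum_add_distrib]
  rw [Finset.sum_congr rfl fun τ _ => mul_comm (e τ) _]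
  ring

theorem width_eq (T K t : ℕ) (v : EuclideanSpace ℝ (Fin d)) :
    width T K t X Ψ v = alpha T K t * √(leverage X Ψ v) := rfl

/-! ### Growth of the Gram determinant -/

theorem det_gram_insert {t : ℕ} (ht : t ∉ Ψ) :
    (gram X (insert t Ψ)).det = (gram X Ψ).det * (1 + leverage X Ψ (X t)) := by
  have h : gram X (insert t Ψ) = gram X Ψ +
      Matrix.replicateCol Unit (X t).ofLp * Matrix.replicateRow Unit (X t).ofLp := by
    rw [gram, Finset.sum_insert ht, gram, Matrix.vecMulVec_eq Unit]
    abel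
  rw [h, Matrix.det_add_replicateCol_mul_replicateRow (isUnit_det_gram X Ψ)]
  congr 1
  rw [Matrix.det_unique, leverage, Matrix.dotProduct_mulVec]
  simp [Matrix.mul_apply, Matrix.vecMul, dotProduct]

/-- The trace is at most `d + T`, and the AM-GM inequality for the eigenvalues turns this into a
bound on the determinant. -/
theorem log_det_gram_le {T : ℕ} (hΨ : Ψ ⊆ Finset.Icc 1 T) (hX : ∀ τ ∈ Ψ, ‖X τ‖ ≤ 1) :
    Real.log (gram X Ψ).det ≤ d * Real.log (1 + T) := by
  have hpd := gram_posDef X Ψ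
  have hT : (0 : ℝ) < 1 + T := by positivity
  have htr : (gram X Ψ).trace ≤ d * (1 + T) := by
    rcases Nat.eq_zero_or_pos d with rfl | hd
    -- The bound `d + T ≤ d * (1 + T)` used below needs `d ≥ 1`, hence the separate case.
    · simp [Matrix.trace]
    have hcard : (Ψ.card : ℝ) ≤ T := by
      exact_mod_cast (Finset.card_le_card hΨ).trans (by simp)
    have : (gram X Ψ).trace = d + ∑ τ ∈ Ψ, ‖X τ‖ ^ 2 := by
      simp only [gram, Matrix.trace_add, Matrix.trace_one, Fintype.card_fin, Matrix.trace_sum,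
        Matrix.trace_vecMulVec]
      congr 1
      refine Finset.sum_congr rfl fun τ _ => ?_
      rw [← inner_eq_dotProduct, real_inner_self_eq_norm_sq]
    have h2 : ∑ τ ∈ Ψ, ‖X τ‖ ^ 2 ≤ ∑ τ ∈ Ψ, (1 : ℝ) :=
      Finset.sum_le_sum fun τ h => pow_le_one₀ (norm_nonneg _) (hX τ h)
    have hd' : (1 : ℝ) ≤ d := by exact_mod_cast hd
    rw [this]
    simp only [Finset.sum_const, nsmul_eq_mul, mul_one] at h2
    nlinarith [(Nat.cast_nonneg T : (0 : ℝ) ≤ T)]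
  have hdet := hpd.isHermitian.det_eq_prod_eigenvalues
  have htr' := hpd.isHermitian.trace_eq_sum_eigenvalues
  simp only [RCLike.ofReal_real_eq_id, id_eq] at hdet htr'
  rw [hdet, Real.log_prod (fun i _ => (hpd.eigenvalues_pos i).ne')]
  -- The tangent of the logarithm at `1 + T`; summed over the eigenvalues, the linear parts are
  -- absorbed by the trace bound.
  have hlog : ∀ i, Real.log (hpd.isHermitian.eigenvalues i) ≤
      hpd.isHermitian.eigenvalues i / (1 + T) - 1 + Real.log (1 + T) := fun i => by
    have hi := hpd.eigenvalues_pos i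
    have := Real.log_le_sub_one_of_pos (div_pos hi hT)
    rw [Real.log_div hi.ne' hT.ne'] at this
    linarith
  refine (Finset.sum_le_sum fun i _ => hlog i).trans ?_
  rw [Finset.sum_add_distrib, Finset.sum_sub_distrib, ← Finset.sum_div, ← htr']
  simp only [Finset.sum_const, Finset.card_univ, Fintype.card_fin, nsmul_eq_mul, mul_one]
  have : (gram X Ψ).trace / (1 + T) ≤ d := by rwa [div_le_iff₀ hT]
  linarith

theorem log_det_gram_nonneg : 0 ≤ Real.log (gram X Ψ).det := by
  refine Real.log_nonneg ?_
  induction Ψ using Finset.induction_on with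
  | empty => simp [gram]
  | insert t Ψ ht ih =>
    rw [det_gram_insert X Ψ ht]
    nlinarith [leverage_nonneg X Ψ (X t)]

theorem gram_congr {X' : ℕ → EuclideanSpace ℝ (Fin d)} (h : ∀ τ ∈ Ψ, X τ = X' τ) :
    gram X Ψ = gram X' Ψ := by
  unfold gram
  congr 1
  exact Finset.sum_congr rfl fun τ hτ => by rw [h τ hτ]

theorem le_two_mul_log_one_add {q : ℝ} (h0 : 0 ≤ q) (h1 : q ≤ 1) : q ≤ 2 * Real.log (1 + q) := by
  have := Real.one_sub_inv_le_log_of_pos (show 0 < 1 + q by linarith)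
  have h2 : q / 2 ≤ 1 - (1 + q)⁻¹ := by
    rw [← one_div, le_sub_iff_add_le, ← le_sub_iff_add_le', div_le_iff₀ (by linarith)]
    nlinarith
  linarith

end LinearAlgebra

/-! ### One round -/

section Round

variable {K : ℕ} {w y : ℕ → Fin K → ℝ}

theorem candidates_congr {w' y' : ℕ → Fin K → ℝ} : ∀ {s : ℕ}, (∀ r < s, w r = w' r) →
    (∀ r < s, y r = y' r) → candidates w y s = candidates w' y' s
  | 0, _, _ => rfl
  | 1, _, _ => rfl
  | s + 2, hw, hy => by
    have ih := candidates_congr (s := s + 1) (fun r hr => hw r (by omega))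
      (fun r hr => hy r (by omega))
    simp only [candidates]
    rw [ih, hw (s + 1) (by omega), hy (s + 1) (by omega)]

theorem phase_eq_iff {T : ℕ} (hT : 1 ≤ T) {s : ℕ} :
    phase T w y = s ↔ 1 ≤ s ∧ ¬ Advances T w y s ∧ ∀ r, 1 ≤ r → r < s → Advances T w y r := by
  have hspec := phase_spec T hT w y
  have hlt : ∀ r, 1 ≤ r → r < phase T w y → Advances T w y r := fun r h1 hr => by
    by_contra h
    exact absurd (Nat.sInf_le (⟨h1, h⟩ : r ∈ {s | 1 ≤ s ∧ ¬ Advances T w y s})) (not_le.2 hr)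
  constructor
  · rintro rfl
    exact ⟨hspec.1, hspec.2.1, hlt⟩
  · rintro ⟨h1, h2, h3⟩
    rcases lt_trichotomy (phase T w y) s with h | h | h
    · exact absurd (h3 _ hspec.1 h) hspec.2.1
    · exact h
    · exact absurd (hlt s h1 h) h2

theorem two_zpow_one_sub (s : ℕ) : (2 : ℝ) ^ (1 - (s : ℤ)) = 2 * (2 : ℝ) ^ (-(s : ℤ)) := by
  rw [sub_eq_add_neg, zpow_add₀ two_ne_zero, zpow_one]

variable {T : ℕ} {μ : Fin K → ℝ} {best : Fin K}

/-- A best arm survives the eliminations as long as the confidence intervals hold. -/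
theorem best_mem_candidates (hbest : ∀ b, μ b ≤ μ best) : ∀ {s : ℕ},
    (∀ r, 1 ≤ r → r < s → Advances T w y r ∧ ∀ a, |y r a - μ a| ≤ w r a) →
    best ∈ candidates w y s
  | 0, _ => Finset.mem_univ _
  | 1, _ => Finset.mem_univ _
  | s + 2, h => by
    obtain ⟨hadv, hconf⟩ := h (s + 1) (by omega) (by omega)
    refine Finset.mem_filter.2 ⟨best_mem_candidates hbest fun r h1 hr => h r h1 (by omega),
      fun b hb => ?_⟩
    have h1 := hadv.2 b hb
    have h2 := abs_le.1 (hconf b)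
    have h3 := abs_le.1 (hconf best)
    have h4 := hbest b
    rw [two_zpow_one_sub]
    linarith

/-- Surviving phase `s - 1` puts the upper bound of `a` within `2 * 2 ^ (-(s - 1))` of that of the
best arm, and the interval of `a` has length at most the same amount. The total is `4 * 2 ^ (-(s -
1))`. -/
theorem sub_le_of_mem_candidates (hbest : ∀ b, μ b ≤ μ best) (hgap : ∀ b, μ best - μ b ≤ 1) {s : ℕ}
    (hs : 1 ≤ s) (h : ∀ r, 1 ≤ r → r < s → Advances T w y r ∧ ∀ a, |y r a - μ a| ≤ w r a)
    {a : Fin K} (ha : a ∈ candidates w y s) : μ best - μ a ≤ 8 * (2 : ℝ) ^ (-(s : ℤ)) := by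
  obtain rfl | ⟨s, rfl⟩ : s = 1 ∨ ∃ r, s = r + 2 := by
    rcases s with _ | _ | s
    · omega
    · exact Or.inl rfl
    · exact Or.inr ⟨s, rfl⟩
  -- Nothing has been eliminated before phase `1`; the claimed bound is `4` there, so gaps at most
  -- `1` suffice.
  · refine (hgap a).trans ?_
    norm_num
  · obtain ⟨hadv, hconf⟩ := h (s + 1) (by omega) (by omega)
    obtain ⟨ha1, ha2⟩ := Finset.mem_filter.1 ha
    have h0 := ha2 best (best_mem_candidates hbest fun r h1 hr => h r h1 (by omega))
    have h1 := hadv.2 a ha1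
    have h2 := abs_le.1 (hconf a)
    have h3 := abs_le.1 (hconf best)
    rw [two_zpow_one_sub] at h0
    have h5 : (2 : ℝ) ^ (-((s + 1 : ℕ) : ℤ)) = 2 * (2 : ℝ) ^ (-((s + 2 : ℕ) : ℤ)) := by
      rw [← two_zpow_one_sub]
      congr 1
    linarith

/-- The index rule loses at most `3 / √T` against every arm alive. -/
theorem sub_le_of_armIndex_le (hT : 1 ≤ T) {v z : Fin K → ℝ} {E : Finset (Fin K)}
    (hconf : ∀ a ∈ E, |z a - μ a| ≤ v a) (htiny : ∀ a ∈ E, v a ≤ 1 / √(T : ℝ)) {top a : Fin K}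
    (htop : top ∈ E) (hmax : ∀ b ∈ E, z b ≤ z top) (ha : a ∈ E)
    (hidx : armIndex T v z top a ≤ armIndex T v z top top) {c : Fin K} (hc : c ∈ E) :
    μ c - μ a ≤ 3 / √(T : ℝ) := by
  have hT0 : (0 : ℝ) < T := by exact_mod_cast hT
  have h3 : 3 / √(T : ℝ) = 3 * (1 / √(T : ℝ)) := by ring
  have hca := abs_le.1 (hconf a ha)
  have hcc := abs_le.1 (hconf c hc)
  have hta := htiny a ha
  have htc := htiny c hc
  have hmc := hmax c hc
  have hpos : 0 < 1 / √(T : ℝ) := by positivity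
  rw [h3]
  by_cases hat : a = top
  · subst hat; linarith
  have hva0 : 0 ≤ v a := (abs_nonneg _).trans (hconf a ha)
  -- The cap `log (2T)` on the index of the empirically best arm is what limits the index of the arm
  -- chosen.
  have hle : armIndex T v z top a ≤ ((Real.log (2 * T) : ℝ) : EReal) :=
    hidx.trans (by rw [armIndex, if_pos rfl]; exact min_le_left _ _)
  rw [armIndex, if_neg hat, negLogSq] at hle
  have hva : v a ≠ 0 := by
    intro h0
    rw [if_pos h0, EReal.coe_add_top, top_le_iff] at hle
    exact EReal.coe_ne_top _ hle
  rw [if_neg hva, ← EReal.coe_add, EReal.coe_le_coe_iff] at hle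
  have hvpos : 0 < v a := lt_of_le_of_ne hva0 (Ne.symm hva)
  have hsq : v a ^ 2 ≤ (T : ℝ)⁻¹ := by
    calc v a ^ 2 ≤ (1 / √(T : ℝ)) ^ 2 := pow_le_pow_left₀ hva0 hta 2
      _ = (T : ℝ)⁻¹ := by rw [div_pow, Real.sq_sqrt hT0.le]; simp
  have hlog : Real.log (v a ^ 2) ≤ - Real.log T := by
    rw [← Real.log_inv]
    exact Real.log_le_log (by positivity) hsq
  -- A width at most `1 / √T` already contributes `log T` to the index, so only `log 2 < 1` remains
  -- for the squared ratio.
  rw [Real.log_mul two_ne_zero hT0.ne'] at hle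
  have hone : ((z top - z a) / v a) ^ 2 ≤ 1 := by
    have := Real.log_two_lt_d9
    linarith
  have hdiv : (z top - z a) / v a ≤ 1 := (abs_le_one_iff_mul_self_le_one.2 (by rwa [← sq])
    |> abs_le.1).2
  rw [div_le_one hvpos] at hdiv
  linarith

end Round

/-! ### The run -/

section Run

variable {d K : ℕ} (T : ℕ) (x : ℕ → Fin K → EuclideanSpace ℝ (Fin d)) (A : ℕ → Fin K) (Y : ℕ → ℝ)

/-- The widths of round `t` in the run. -/
abbrev roundWidths (t : ℕ) : ℕ → Fin K → ℝ := widths T x A t (indexSets T x A Y t)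

/-- The sample means of round `t` in the run. -/
abbrev roundMeans (t : ℕ) : ℕ → Fin K → ℝ := sampleMeans x A Y t (indexSets T x A Y t)

/-- The phase in which the arm of round `t` is chosen. -/
abbrev roundPhase (t : ℕ) : ℕ := phase T (roundWidths T x A Y t) (roundMeans T x A Y t)

/-- The arm of round `t` is chosen because of its large width. -/
def Explores (t : ℕ) : Prop :=
  ¬ AllTiny T (roundWidths T x A Y t) (roundMeans T x A Y t) (roundPhase T x A Y t)

/-- The number of phases that suffices for every round. -/
def maxPhase : ℕ := max 1 ⌈Real.log T⌉₊

/-- All confidence intervals of round `t` contain the mean rewards. -/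
def Confident (θ : EuclideanSpace ℝ (Fin d)) (t : ℕ) : Prop :=
  ∀ s ∈ Finset.Icc 1 (maxPhase T), ∀ a,
    |roundMeans T x A Y t s a - inner ℝ θ (x t a)| ≤ roundWidths T x A Y t s a

open Classical in
/-- The squared `V⁻¹`-norm of the context played in round `t` if the arm was chosen because of its
large width, and `0` otherwise. -/
def exploredLeverage (t : ℕ) : ℝ :=
  if Explores T x A Y t then
    leverage (fun τ => x τ (A τ)) (indexSets T x A Y t (roundPhase T x A Y t)) (x t (A t))
  else 0

theorem indexSets_succ_of_mem {t s : ℕ} (ht : 1 ≤ t) (hs : roundPhase T x A Y t = s)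
    (he : Explores T x A Y t) : indexSets T x A Y (t + 1) s = insert t (indexSets T x A Y t s) := by
  subst hs
  exact if_pos ⟨ht, rfl, he⟩

theorem indexSets_succ_of_notMem {t s : ℕ}
    (h : ¬ (1 ≤ t ∧ roundPhase T x A Y t = s ∧ Explores T x A Y t)) :
    indexSets T x A Y (t + 1) s = indexSets T x A Y t s := by
  refine if_neg ?_
  rintro ⟨ht, rfl, he⟩
  exact h ⟨ht, rfl, he⟩

theorem indexSets_subset (t s : ℕ) : indexSets T x A Y t s ⊆ Finset.Ico 1 t := by
  induction t with
  | zero => exact Finset.empty_subset _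
  | succ t ih =>
    have hsub : indexSets T x A Y t s ⊆ Finset.Ico 1 (t + 1) :=
      ih.trans (Finset.Ico_subset_Ico_right (by omega))
    by_cases h : 1 ≤ t ∧ roundPhase T x A Y t = s ∧ Explores T x A Y t
    · rw [indexSets_succ_of_mem T x A Y h.1 h.2.1 h.2.2]
      exact Finset.insert_subset (Finset.mem_Ico.2 ⟨h.1, by omega⟩) hsub
    · rwa [indexSets_succ_of_notMem T x A Y h]

theorem roundPhase_mem (hT : 1 ≤ T) (t : ℕ) : roundPhase T x A Y t ∈ Finset.Icc 1 (maxPhase T) := by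
  have := phase_spec T hT (roundWidths T x A Y t) (roundMeans T x A Y t)
  exact Finset.mem_Icc.2 ⟨this.1, this.2.2⟩

theorem exploredLeverage_nonneg (t : ℕ) : 0 ≤ exploredLeverage T x A Y t := by
  unfold exploredLeverage
  split_ifs
  exacts [leverage_nonneg _ _ _, le_rfl]

/-- The elliptical potential argument, for all phases at once. -/
theorem sum_exploredLeverage_le_log_det (hT : 1 ≤ T) {n : ℕ}
    (hx : ∀ t ∈ Finset.Icc 1 n, ∀ a, ‖x t a‖ ≤ 1) :
    ∑ t ∈ Finset.Icc 1 n, exploredLeverage T x A Y t ≤ 2 * ∑ s ∈ Finset.Icc 1 (maxPhase T),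
      Real.log (gram (fun τ => x τ (A τ)) (indexSets T x A Y (n + 1) s)).det := by
  induction n with
  | zero =>
    simp only [zero_lt_one, Finset.Icc_eq_empty_of_lt, Finset.sum_empty]
    exact mul_nonneg zero_le_two (Finset.sum_nonneg fun _ _ => log_det_gram_nonneg _ _)
  | succ n ih =>
    specialize ih fun t ht => hx t (Finset.Icc_subset_Icc_right (by omega) ht)
    rw [Finset.sum_Icc_succ_top (by omega)]
    by_cases he : Explores T x A Y (n + 1)
    · set p := roundPhase T x A Y (n + 1) with hp
      have hpm : p ∈ Finset.Icc 1 (maxPhase T) := roundPhase_mem T x A Y hT (n + 1)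
      rw [← Finset.add_sum_erase _ _ hpm] at ih ⊢
      have hrest : ∑ s ∈ (Finset.Icc 1 (maxPhase T)).erase p,
            Real.log (gram (fun τ => x τ (A τ)) (indexSets T x A Y (n + 1 + 1) s)).det =
          ∑ s ∈ (Finset.Icc 1 (maxPhase T)).erase p,
            Real.log (gram (fun τ => x τ (A τ)) (indexSets T x A Y (n + 1) s)).det := by
        refine Finset.sum_congr rfl fun s hs => ?_
        rw [indexSets_succ_of_notMem]
        exact fun h => (Finset.mem_erase.1 hs).1 h.2.1.symm
      rw [hrest, indexSets_succ_of_mem T x A Y (by omega) hp.symm he, det_gram_insert,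
        Real.log_mul]
      · have h1 := le_two_mul_log_one_add (leverage_nonneg (fun τ => x τ (A τ))
          (indexSets T x A Y (n + 1) p) (x (n + 1) (A (n + 1)))) (leverage_le_one _ _
            (hx (n + 1) (Finset.mem_Icc.2 ⟨by omega, le_rfl⟩) (A (n + 1))))
        have h2 : exploredLeverage T x A Y (n + 1) = leverage (fun τ => x τ (A τ))
          (indexSets T x A Y (n + 1) p) (x (n + 1) (A (n + 1))) := if_pos he
        rw [h2]
        linarith
      · exact (gram_posDef _ _).det_pos.ne'
      · have := leverage_nonneg (fun τ => x τ (A τ))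
          (indexSets T x A Y (n + 1) p) (x (n + 1) (A (n + 1)))
        positivity
      · intro h
        exact absurd (Finset.mem_Ico.1 (indexSets_subset T x A Y _ _ h)).2 (lt_irrefl _)
    · rw [exploredLeverage, if_neg he, add_zero]
      refine ih.trans_eq ?_
      congr 1
      refine Finset.sum_congr rfl fun s _ => ?_
      rw [indexSets_succ_of_notMem T x A Y fun h => he h.2.2]

theorem sum_exploredLeverage_le (hT : 1 ≤ T) (hx : ∀ t ∈ Finset.Icc 1 T, ∀ a, ‖x t a‖ ≤ 1) :
    ∑ t ∈ Finset.Icc 1 T, exploredLeverage T x A Y t ≤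
      2 * (maxPhase T * (d * Real.log (1 + T))) := by
  refine (sum_exploredLeverage_le_log_det T x A Y hT hx).trans ?_
  gcongr
  refine (Finset.sum_le_card_nsmul _ _ (d * Real.log (1 + T)) fun s _ => ?_).trans_eq (by simp)
  have hsub : indexSets T x A Y (T + 1) s ⊆ Finset.Icc 1 T := fun τ hτ => by
    have := Finset.mem_Ico.1 (indexSets_subset T x A Y _ _ hτ)
    exact Finset.mem_Icc.2 ⟨this.1, by omega⟩
  exact log_det_gram_le _ _ hsub fun τ hτ => hx τ (hsub hτ) _

variable {T x A Y}

theorem exists_gap_eq (hK : 1 ≤ K) (θ : EuclideanSpace ℝ (Fin d)) (t : ℕ) :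
    ∃ best, (∀ b, inner ℝ θ (x t b) ≤ inner ℝ θ (x t best)) ∧
      ∀ b, gap x θ t b = inner ℝ θ (x t best) - inner ℝ θ (x t b) := by
  have : Nonempty (Fin K) := ⟨⟨0, hK⟩⟩
  obtain ⟨best, hbest⟩ := exists_eq_ciSup_of_finite (f := fun a => inner ℝ θ (x t a))
  refine ⟨best, fun b => ?_, fun b => by rw [gap, ← hbest]⟩
  rw [hbest]
  exact le_ciSup (f := fun a => inner ℝ θ (x t a)) (Set.finite_range _).bddAbove b

theorem alpha_nonneg (T K t : ℕ) : 0 ≤ alpha T K t := Real.sqrt_nonneg _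

/-- In a round where the confidence intervals hold, the loss is `3 / √T`, or of the order of the
width of the arm played. -/
theorem gap_le_of_confident (hK : 1 ≤ K) (hT : 1 ≤ T)
    {ρ : ℕ → ℕ → (Fin K → ℝ) → Finset (Fin K) → Fin K} (hρ : ∀ t s w E, E.Nonempty → ρ t s w E ∈ E)
    (hA : Follows T x ρ A Y) {θ : EuclideanSpace ℝ (Fin d)} {t : ℕ} (ht : t ∈ Finset.Icc 1 T)
    (hgap : ∀ b, gap x θ t b ≤ 1) (hconf : Confident T x A Y θ t) :
    gap x θ t (A t) ≤ 3 / √(T : ℝ) + 8 * (alpha T K t * √(exploredLeverage T x A Y t)) := by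
  obtain ⟨best, hbest, hgap_eq⟩ := exists_gap_eq (x := x) hK θ t
  simp only [hgap_eq] at hgap ⊢
  obtain ⟨hidx, hexp⟩ := hA t ht
  obtain ⟨hp1, hpS⟩ := Finset.mem_Icc.1 (roundPhase_mem T x A Y hT t)
  obtain ⟨-, hnadv, hadv⟩ := (phase_eq_iff (w := roundWidths T x A Y t)
    (y := roundMeans T x A Y t) hT).1 rfl
  have hall : ∀ r, 1 ≤ r → r < roundPhase T x A Y t →
      Advances T (roundWidths T x A Y t) (roundMeans T x A Y t) r ∧
      ∀ a, |roundMeans T x A Y t r a - inner ℝ θ (x t a)| ≤ roundWidths T x A Y t r a :=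
    fun r h1 hr => ⟨hadv r h1 hr, hconf r (Finset.mem_Icc.2 ⟨h1, hr.le.trans hpS⟩)⟩
  have hbm := best_mem_candidates hbest hall
  by_cases he : Explores T x A Y t
  -- The final phase does not advance and is not tiny, so some width exceeds `2 ^ (-s)` and the rule
  -- `ρ` is applied to a nonempty set.
  · have hns : ¬ AllSmall (roundWidths T x A Y t) (roundMeans T x A Y t) (roundPhase T x A Y t) :=
      fun h => hnadv ⟨he, h⟩
    have hmem : A t ∈ (candidates (roundWidths T x A Y t) (roundMeans T x A Y t)
        (roundPhase T x A Y t)).filter fun a => (2 : ℝ) ^ (-(roundPhase T x A Y t : ℤ)) <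
          roundWidths T x A Y t (roundPhase T x A Y t) a := by
      rw [hexp he]
      apply hρ
      unfold AllSmall at hns
      push Not at hns
      obtain ⟨a, ha, hlt⟩ := hns
      exact ⟨a, Finset.mem_filter.2 ⟨ha, hlt⟩⟩
    obtain ⟨hm, hlt⟩ := Finset.mem_filter.1 hmem
    have h8 := sub_le_of_mem_candidates hbest hgap hp1 hall hm
    have hq : exploredLeverage T x A Y t = leverage (fun τ => x τ (A τ))
      (indexSets T x A Y t (roundPhase T x A Y t)) (x t (A t)) := if_pos he
    have hw : roundWidths T x A Y t (roundPhase T x A Y t) (A t) =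
        alpha T K t * √(exploredLeverage T x A Y t) := by
      rw [hq]; rfl
    rw [hw] at hlt
    have : 0 ≤ 3 / √(T : ℝ) := by positivity
    linarith
  · obtain ⟨top, htop, hmax, hAm, hmin⟩ := hidx (not_not.1 he)
    have := sub_le_of_armIndex_le (μ := fun a => inner ℝ θ (x t a)) hT
      (fun a _ => hconf _ (roundPhase_mem T x A Y hT t) a)
      (not_not.1 he) htop hmax hAm (hmin top htop) hbm
    have h0 : 0 ≤ 8 * (alpha T K t * √(exploredLeverage T x A Y t)) :=
      mul_nonneg (by norm_num) (mul_nonneg (alpha_nonneg _ _ _) (Real.sqrt_nonneg _))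
    linarith

theorem alpha_arg (T K : ℕ) {t : ℕ} : 2 * T * K / gamma t = 4 * (T : ℝ) * K * t ^ 2 := by
  rw [gamma, one_div, div_inv_eq_mul]
  ring

theorem alpha_mono (hT : 1 ≤ T) (hK : 1 ≤ K) {s t : ℕ} (hs : 1 ≤ s) (hst : s ≤ t) :
    alpha T K s ≤ alpha T K t := by
  have hT0 : (0 : ℝ) < T := by exact_mod_cast hT
  have hK0 : (0 : ℝ) < K := by exact_mod_cast hK
  have hs0 : (0 : ℝ) < s := by exact_mod_cast hs
  unfold alpha
  rw [alpha_arg, alpha_arg]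
  gcongr

/-- This is a pathwise bound. The function `f` stands for any majorant of the indicator of the
failing rounds, so that a measurable one can be inserted before integrating. -/
theorem sum_gap_le (hK : 1 ≤ K) (hT : 1 ≤ T)
    {ρ : ℕ → ℕ → (Fin K → ℝ) → Finset (Fin K) → Fin K} (hρ : ∀ t s w E, E.Nonempty → ρ t s w E ∈ E)
    (hA : Follows T x ρ A Y) {θ : EuclideanSpace ℝ (Fin d)}
    (hx : ∀ t ∈ Finset.Icc 1 T, ∀ a, ‖x t a‖ ≤ 1)
    (hgap : ∀ t ∈ Finset.Icc 1 T, ∀ b, gap x θ t b ≤ 1) {f : ℕ → ℝ}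
    (hf0 : ∀ t ∈ Finset.Icc 1 T, 0 ≤ f t)
    (hf : ∀ t ∈ Finset.Icc 1 T, ¬ Confident T x A Y θ t → 1 ≤ f t) :
    ∑ t ∈ Finset.Icc 1 T, gap x θ t (A t) ≤ ∑ t ∈ Finset.Icc 1 T, f t + (3 * √(T : ℝ) +
      8 * (alpha T K T * √(T * (2 * (maxPhase T * (d * Real.log (1 + T))))))) := by
  have hT0 : (0 : ℝ) < T := by exact_mod_cast hT
  have hround : ∀ t ∈ Finset.Icc 1 T, gap x θ t (A t) ≤
      f t + (3 / √(T : ℝ) + 8 * (alpha T K T * √(exploredLeverage T x A Y t))) := by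
    intro t ht
    obtain ⟨ht1, htT⟩ := Finset.mem_Icc.1 ht
    have h8 : 0 ≤ 8 * (alpha T K T * √(exploredLeverage T x A Y t)) :=
      mul_nonneg (by norm_num) (mul_nonneg (alpha_nonneg _ _ _) (Real.sqrt_nonneg _))
    have h3 : 0 ≤ 3 / √(T : ℝ) := by positivity
    by_cases hc : Confident T x A Y θ t
    · have h1 := gap_le_of_confident hK hT hρ hA ht (hgap t ht) hc
      have h2 : alpha T K t * √(exploredLeverage T x A Y t) ≤
          alpha T K T * √(exploredLeverage T x A Y t) :=
        mul_le_mul_of_nonneg_right (alpha_mono hT hK ht1 htT) (Real.sqrt_nonneg _)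
      linarith [hf0 t ht]
    · linarith [hgap t ht (A t), hf t ht hc]
  refine (Finset.sum_le_sum hround).trans ?_
  rw [Finset.sum_add_distrib, Finset.sum_add_distrib, ← Finset.mul_sum, ← Finset.mul_sum]
  gcongr
  · simp only [Finset.sum_const, Nat.card_Icc, add_tsub_cancel_right, nsmul_eq_mul]
    refine le_of_eq ?_
    have := Real.mul_self_sqrt hT0.le
    field_simp
    nlinarith
  · exact alpha_nonneg _ _ _
  -- Cauchy–Schwarz over the rounds, then the elliptical potential bound.
  · refine Real.le_sqrt_of_sq_le (sq_sum_le_card_mul_sum_sq.trans ?_)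
    rw [Finset.sum_congr rfl fun t _ => Real.sq_sqrt (exploredLeverage_nonneg T x A Y t)]
    simp only [Nat.card_Icc, add_tsub_cancel_right]
    exact mul_le_mul_of_nonneg_left (sum_exploredLeverage_le T x A Y hT hx) hT0.le

end Run

/-! ### The tail of the estimation error -/

section Tail

variable {Ω : Type*} [MeasurableSpace Ω] {P : Measure Ω}

/-- The tail of a sub-Gaussian noise plus a bias `b` with `|b| ≤ β`, when `β ^ 2` and four times the
variance proxy add up to `q`: the bias costs only a constant factor. -/
theorem measure_lt_abs_sub_le [IsProbabilityMeasure P] {Z : Ω → ℝ} {c : ℝ≥0} (hZ : HasSubgaussianMGF Z c P)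
    {α q β b : ℝ} (hα : 0 ≤ α) (hq : 0 ≤ q) (hb : |b| ≤ β) (hc : 4 * (c : ℝ) + β ^ 2 ≤ q) :
    P {ω | α * √q < |Z ω - b|} ≤ ENNReal.ofReal (2 * Real.exp (2 - 2 * α ^ 2)) := by
  have hβ : 0 ≤ β := (abs_nonneg b).trans hb
  rcases lt_or_ge α 1 with h1 | h1
  -- For `α < 1` the right-hand side exceeds `1`.
  · refine prob_le_one.trans ?_
    rw [ENNReal.one_le_ofReal]
    have := Real.one_le_exp (show 0 ≤ 2 - 2 * α ^ 2 by nlinarith)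
    linarith
  have hsq := Real.sq_sqrt hq
  have hβq : β ≤ √q := Real.le_sqrt_of_sq_le (by linarith [c.coe_nonneg])
  have hε : 0 ≤ α * √q - β := by nlinarith [Real.sqrt_nonneg q]
  -- With `c = 0` the exponent of the Chernoff bound is a division by zero and says nothing, but
  -- then the noise vanishes almost surely.
  rcases eq_or_ne c 0 with rfl | hc0
  · have h0 := hZ.ae_eq_zero_of_hasSubgaussianMGF_zero
    have : P {ω | α * √q < |Z ω - b|} = 0 := by
      rw [← compl_compl {ω | α * √q < |Z ω - b|}]
      refine mem_ae_iff.1 ?_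
      filter_upwards [h0] with ω hω
      simp only [Set.mem_compl_iff, Set.mem_ofPred_eq, hω, Pi.zero_apply, zero_sub, abs_neg, not_lt]
      linarith
    rw [this]
    exact zero_le
  have hcpos : (0 : ℝ) < c := by exact_mod_cast pos_iff_ne_zero.2 hc0
  have hexp : Real.exp (-(α * √q - β) ^ 2 / (2 * c)) ≤ Real.exp (2 - 2 * α ^ 2) := by
    rw [Real.exp_le_exp, div_le_iff₀ (by positivity)]
    have h2 : (α ^ 2 - 1) * (4 * c) ≤ (α ^ 2 - 1) * (q - β ^ 2) :=
      mul_le_mul_of_nonneg_left (by linarith) (by nlinarith)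
    -- The identity `(α√q - β)² - (α² - 1)(q - β²) = (√q - αβ)²` shows that the bias costs only the
    -- factor `e²`.
    nlinarith [sq_nonneg (√q - α * β)]
  have hsub : {ω | α * √q < |Z ω - b|} ⊆
      {ω | α * √q - β ≤ Z ω} ∪ {ω | α * √q - β ≤ (-Z) ω} := by
    intro ω hω
    simp only [Set.mem_ofPred_eq, Set.mem_union, Pi.neg_apply, lt_abs] at hω ⊢
    have := abs_le.1 hb
    rcases hω with h | h
    · left; linarith
    · right; linarith
  have hpos := (hZ.measure_ge_le hε).trans hexp
  have hneg := (hZ.neg.measure_ge_le hε).trans hexp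
  calc P {ω | α * √q < |Z ω - b|}
      ≤ P {ω | α * √q - β ≤ Z ω} + P {ω | α * √q - β ≤ (-Z) ω} :=
        (measure_mono hsub).trans (measure_union_le _ _)
    _ ≤ ENNReal.ofReal (Real.exp (2 - 2 * α ^ 2)) + ENNReal.ofReal (Real.exp (2 - 2 * α ^ 2)) := by
        rw [← ofReal_measureReal, ← ofReal_measureReal]
        gcongr
    _ = ENNReal.ofReal (2 * Real.exp (2 - 2 * α ^ 2)) := by
        rw [← ENNReal.ofReal_add (Real.exp_pos _).le (Real.exp_pos _).le,
          ← two_mul]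

/-! ### Confidence intervals for a deterministic design -/

variable {K : ℕ} {R : ℝ≥0} {η : ℕ → Fin K → Ω → ℝ}

theorem iIndepFun_arm (hind : iIndepFun (fun t ω a => η t a ω) P) (a : ℕ → Fin K) :
    iIndepFun (fun t => η t (a t)) P :=
  hind.comp (fun t (e : Fin K → ℝ) => e (a t)) fun t => measurable_pi_apply (a t)

/-- The confidence interval of ridge regression fails with small probability when the rounds used
and the arms played there are not random. -/
theorem measure_width_lt_error_le [IsProbabilityMeasure P] {d : ℕ} (hR : R ≤ 1 / 2)
    (hη : ∀ t a, HasSubgaussianMGF (η t a) (R ^ 2) P)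
    (hind : iIndepFun (fun t ω a => η t a ω) P) {θ : EuclideanSpace ℝ (Fin d)} (hθ : ‖θ‖ ≤ 1)
    (T t : ℕ) (X : ℕ → EuclideanSpace ℝ (Fin d)) (a : ℕ → Fin K) (Ψ : Finset ℕ)
    (v : EuclideanSpace ℝ (Fin d)) :
    P {ω | width T K t X Ψ v <
        |sampleMean X (fun τ => inner ℝ θ (X τ) + η τ (a τ) ω) Ψ v - inner ℝ θ v|} ≤
      ENNReal.ofReal (2 * Real.exp (2 - 2 * alpha T K t ^ 2)) := by
  simp only [sampleMean_sub_inner, width_eq]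
  have hsum := HasSubgaussianMGF.sum_of_iIndepFun (s := Ψ)
    (X := fun τ ω => inner ℝ (X τ) (weightVector X Ψ v) * η τ (a τ) ω)
    ((iIndepFun_arm hind a).comp (fun τ e => inner ℝ (X τ) (weightVector X Ψ v) * e)
      fun τ => measurable_const_mul _)
    (fun τ _ => (hη τ (a τ)).const_mul (inner ℝ (X τ) (weightVector X Ψ v)))
  refine measure_lt_abs_sub_le hsum (alpha_nonneg T K t) (leverage_nonneg X Ψ v)
    (β := ‖weightVector X Ψ v‖) ?_ ?_
  · exact (abs_real_inner_le_norm _ _).trans (mul_le_of_le_one_left (norm_nonneg _) hθ)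
  · rw [leverage_eq, add_comm]
    gcongr
    push_cast
    rw [Finset.mul_sum]
    refine Finset.sum_le_sum fun τ _ => ?_
    -- Here `R ≤ 1/2` makes four times the variance proxy fit into the second term of `leverage_eq`.
    have hR' : (R : ℝ) ≤ 1 / 2 := by exact_mod_cast hR
    have hR2 : 4 * (R : ℝ) ^ 2 ≤ 1 := by nlinarith [R.coe_nonneg]
    change 4 * (inner ℝ (X τ) (weightVector X Ψ v) ^ 2 * (R : ℝ) ^ 2) ≤ _
    nlinarith [sq_nonneg (inner ℝ (X τ) (weightVector X Ψ v))]

theorem exp_alpha {T K t : ℕ} (hT : 1 ≤ T) (hK : 1 ≤ K) (ht : 1 ≤ t) :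
    Real.exp (-(2 * alpha T K t ^ 2)) = (4 * (T : ℝ) * K * t ^ 2)⁻¹ := by
  have h1 : (1 : ℝ) ≤ 4 * (T : ℝ) * K * t ^ 2 := by
    have : 1 ≤ 4 * T * K * t ^ 2 := Nat.succ_le_of_lt (by positivity)
    exact_mod_cast this
  rw [alpha, alpha_arg, Real.sq_sqrt (by have := Real.log_nonneg h1; positivity),
    show -(2 * (1 / 2 * Real.log (4 * (T : ℝ) * K * t ^ 2))) =
      -Real.log (4 * (T : ℝ) * K * t ^ 2) by ring, Real.exp_neg, Real.exp_log (by linarith)]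

end Tail

/-! ### Measurability and locality of the phases of one round -/

section Phases

variable {K : ℕ}

/-- The asymmetry `r ≤ s` for widths against `r < s` for means is the source of independence: the
candidates of phase `s` come from earlier phases, and the tests in phase `s` read widths only. -/
theorem phase_congr {T : ℕ} (hT : 1 ≤ T) {w y w' y' : ℕ → Fin K → ℝ} {s : ℕ}
    (hw : ∀ r ≤ s, w r = w' r) (hy : ∀ r < s, y r = y' r) :
    phase T w y = s ↔ phase T w' y' = s := by
  have hadv : ∀ r ≤ s, (Advances T w y r ↔ Advances T w' y' r) := fun r hr => by
    unfold Advances AllTiny AllSmall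
    rw [candidates_congr (fun q hq => hw q (by omega)) fun q hq => hy q (by omega), hw r hr]
  rw [phase_eq_iff hT, phase_eq_iff hT, hadv s le_rfl]
  refine and_congr_right fun _ => and_congr_right fun _ => forall₂_congr fun r _ =>
    forall_congr' fun hr => hadv r hr.le

open Classical in
/-- With widths `w` and sample means `y`, the arm of round `t` is chosen in phase `r` because of its
large width, and it is `a`. -/
def ExploresArm (T : ℕ) (ρ : ℕ → ℕ → (Fin K → ℝ) → Finset (Fin K) → Fin K) (t : ℕ)
    (w y : ℕ → Fin K → ℝ) (r : ℕ) (a : Fin K) : Prop :=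
  phase T w y = r ∧ ¬ AllTiny T w y r ∧
    ρ t r (w r) ((candidates w y r).filter fun a => (2 : ℝ) ^ (-(r : ℤ)) < w r a) = a

theorem exploresArm_congr {T : ℕ} (hT : 1 ≤ T)
    {ρ : ℕ → ℕ → (Fin K → ℝ) → Finset (Fin K) → Fin K} {t : ℕ} {w y w' y' : ℕ → Fin K → ℝ} {s : ℕ}
    (hw : ∀ r ≤ s, w r = w' r) (hy : ∀ r < s, y r = y' r) (a : Fin K) :
    ExploresArm T ρ t w y s a ↔ ExploresArm T ρ t w' y' s a := by
  unfold ExploresArm AllTiny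
  rw [phase_congr hT hw hy, candidates_congr (fun q hq => hw q hq.le) hy, hw s le_rfl]

variable {Ω : Type*} [MeasurableSpace Ω] {w : ℕ → Fin K → ℝ} {y : Ω → ℕ → Fin K → ℝ}

theorem measurableSet_of_mem_candidates : ∀ {s : ℕ},
    (∀ r < s, ∀ b, Measurable fun ω => y ω r b) →
    ∀ a, MeasurableSet {ω | a ∈ candidates w (y ω) s}
  | 0, _, a => by simp [candidates]
  | 1, _, a => by simp [candidates]
  | s + 2, hy, a => by
    have ih := measurableSet_of_mem_candidates (s := s + 1) fun r hr => hy r (by omega)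
    have hs := hy (s + 1) (by omega)
    have : {ω | a ∈ candidates w (y ω) (s + 2)} = {ω | a ∈ candidates w (y ω) (s + 1)} ∩
        ⋂ b, ({ω | b ∈ candidates w (y ω) (s + 1)}ᶜ ∪ {ω | y ω (s + 1) b + w (s + 1) b -
          (2 : ℝ) ^ (1 - ((s + 1 : ℕ) : ℤ)) ≤ y ω (s + 1) a + w (s + 1) a}) := by
      ext ω
      simp [candidates, imp_iff_not_or]
    rw [this]
    exact (ih a).inter (MeasurableSet.iInter fun b => (ih b).compl.union
      (measurableSet_le (((hs b).add_const _).sub_const _) ((hs a).add_const _)))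

theorem measurableSet_candidates {s : ℕ} (hy : ∀ r < s, ∀ b, Measurable fun ω => y ω r b)
    (p : Finset (Fin K) → Prop) : MeasurableSet {ω | p (candidates w (y ω) s)} := by
  have heq : ∀ E : Finset (Fin K), MeasurableSet {ω | candidates w (y ω) s = E} := fun E => by
    have : {ω | candidates w (y ω) s = E} =
        ⋂ a, {ω | a ∈ candidates w (y ω) s ↔ a ∈ E} := by
      ext ω
      simp [Finset.ext_iff]
    rw [this]
    refine MeasurableSet.iInter fun a => ?_
    have ha := measurableSet_of_mem_candidates (w := w) hy a
    by_cases h : a ∈ E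
    · simpa only [h, iff_true] using ha
    · simp only [h, iff_false]
      exact ha.compl
  have : {ω | p (candidates w (y ω) s)} = ⋃ E ∈ {E | p E}, {ω | candidates w (y ω) s = E} := by
    ext ω
    simp
  rw [this]
  exact MeasurableSet.biUnion (Set.to_countable _) fun E _ => heq E

theorem measurableSet_exploresArm {T : ℕ} (hT : 1 ≤ T)
    {ρ : ℕ → ℕ → (Fin K → ℝ) → Finset (Fin K) → Fin K} {t s : ℕ}
    (hy : ∀ r < s, ∀ b, Measurable fun ω => y ω r b) (a : Fin K) :
    MeasurableSet {ω | ExploresArm T ρ t w (y ω) s a} := by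
  have hadv : ∀ r ≤ s, MeasurableSet {ω | Advances T w (y ω) r} := fun r hr =>
    measurableSet_candidates (w := w) (fun q hq => hy q (by omega)) fun E =>
      ¬ (∀ a ∈ E, w r a ≤ 1 / √(T : ℝ)) ∧ ∀ a ∈ E, w r a ≤ (2 : ℝ) ^ (-(r : ℤ))
  have hphase : MeasurableSet {ω | phase T w (y ω) = s} := by
    have : {ω | phase T w (y ω) = s} = {_ω | 1 ≤ s} ∩ ({ω | Advances T w (y ω) s}ᶜ ∩
        ⋂ r ∈ Finset.Ico 1 s, {ω | Advances T w (y ω) r}) := by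
      ext ω
      simp only [Set.mem_ofPred_eq, phase_eq_iff hT, Set.mem_inter_iff, Set.mem_compl_iff,
        Set.mem_iInter, Finset.mem_Ico, and_imp]
    rw [this]
    exact (MeasurableSet.const _).inter ((hadv s le_rfl).compl.inter
      (Finset.measurableSet_biInter _ fun r hr => hadv r (Finset.mem_Ico.1 hr).2.le))
  classical
  exact hphase.inter (measurableSet_candidates (w := w) hy fun E =>
    ¬ (∀ a ∈ E, w s a ≤ 1 / √(T : ℝ)) ∧
      ρ t s (w s) (@Finset.filter _ (fun a => (2 : ℝ) ^ (-(s : ℤ)) < w s a)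
        (fun _ => Classical.propDecidable _) E) = a)

end Phases

/-! ### The history of the index sets

The history up to phase `s` records for every round the phase and the arm if the arm was chosen
because of its large width in a phase up to `s`. Along a fixed history the widths are constant, and
the history up to phase `s` depends only on the noise in rounds of the earlier phases. -/

section History

variable {d K : ℕ}

theorem mem_indexSets {T : ℕ} {x : ℕ → Fin K → EuclideanSpace ℝ (Fin d)} {A : ℕ → Fin K}
    {Y : ℕ → ℝ} {t s τ : ℕ} : τ ∈ indexSets T x A Y t s ↔
      τ < t ∧ 1 ≤ τ ∧ roundPhase T x A Y τ = s ∧ Explores T x A Y τ := by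
  induction t with
  | zero => simp [indexSets]
  | succ t ih =>
    by_cases h : 1 ≤ t ∧ roundPhase T x A Y t = s ∧ Explores T x A Y t
    · rw [indexSets_succ_of_mem T x A Y h.1 h.2.1 h.2.2, Finset.mem_insert, ih]
      constructor
      · rintro (rfl | h')
        · exact ⟨by omega, h⟩
        · exact ⟨by omega, h'.2⟩
      · rintro ⟨h1, h2⟩
        rcases Nat.lt_succ_iff_lt_or_eq.1 h1 with h3 | h3
        · exact Or.inr ⟨h3, h2⟩
        · exact Or.inl h3
    · rw [indexSets_succ_of_notMem T x A Y h, ih]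
      refine ⟨fun h' => ⟨by omega, h'.2⟩, fun h' => ⟨?_, h'.2⟩⟩
      rcases Nat.lt_succ_iff_lt_or_eq.1 h'.1 with h3 | rfl
      · exact h3
      · exact absurd h'.2 h

open Classical in
/-- The phase and the arm of a round if the arm was chosen because of its large width in a phase up
to `s`. -/
def roundLabel (T : ℕ) (x : ℕ → Fin K → EuclideanSpace ℝ (Fin d)) (A : ℕ → Fin K) (Y : ℕ → ℝ)
    (s τ : ℕ) : Option (ℕ × Fin K) :=
  if 1 ≤ τ ∧ roundPhase T x A Y τ ≤ s ∧ Explores T x A Y τ then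
    some (roundPhase T x A Y τ, A τ) else none

theorem roundLabel_eq_some {T : ℕ} {x : ℕ → Fin K → EuclideanSpace ℝ (Fin d)} {A : ℕ → Fin K}
    {Y : ℕ → ℝ} {s τ r : ℕ} {a : Fin K} : roundLabel T x A Y s τ = some (r, a) ↔
      1 ≤ τ ∧ r ≤ s ∧ roundPhase T x A Y τ = r ∧ Explores T x A Y τ ∧ A τ = a := by
  unfold roundLabel
  split_ifs with h
  · simp only [Option.some.injEq, Prod.mk.injEq]
    constructor
    · rintro ⟨rfl, rfl⟩
      exact ⟨h.1, h.2.1, rfl, h.2.2, rfl⟩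
    · rintro ⟨-, -, h3, -, h5⟩
      exact ⟨h3, h5⟩
  · simp only [false_iff]
    rintro ⟨h1, h2, rfl, h4, -⟩
    exact h ⟨h1, h2, h4⟩

/-- The index set of phase `r` before round `t` in the history `c`. -/
def historySet (c : ℕ → Option (ℕ × Fin K)) (t r : ℕ) : Finset ℕ :=
  (Finset.range t).filter fun τ => (c τ).map Prod.fst = some r

/-- The arm played in round `τ` according to the history `c`. -/
def historyArm (a₀ : Fin K) (c : ℕ → Option (ℕ × Fin K)) (τ : ℕ) : Fin K :=
  ((c τ).map Prod.snd).getD a₀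

variable {T : ℕ} (x : ℕ → Fin K → EuclideanSpace ℝ (Fin d)) (θ : EuclideanSpace ℝ (Fin d))
  (a₀ : Fin K)

/-- The rewards in a run with arms `A` and noise `e`. -/
abbrev rewards (A : ℕ → Fin K) (e : ℕ → Fin K → ℝ) (τ : ℕ) : ℝ :=
  inner ℝ θ (x τ (A τ)) + e τ (A τ)

variable (T) in
/-- The widths of round `t` along the history `c`. -/
def historyWidths (c : ℕ → Option (ℕ × Fin K)) (t r : ℕ) (a : Fin K) : ℝ :=
  width T K t (fun τ => x τ (historyArm a₀ c τ)) (historySet c t r) (x t a)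

/-- The sample means of round `t` along the history `c`. -/
def historyMeans (e : ℕ → Fin K → ℝ) (c : ℕ → Option (ℕ × Fin K)) (t r : ℕ) (a : Fin K) : ℝ :=
  sampleMean (fun τ => x τ (historyArm a₀ c τ)) (rewards x θ (historyArm a₀ c) e)
    (historySet c t r) (x t a)

theorem sampleMean_congr {X X' : ℕ → EuclideanSpace ℝ (Fin d)} {Y Y' : ℕ → ℝ} {Ψ : Finset ℕ}
    (hX : ∀ τ ∈ Ψ, X τ = X' τ) (hY : ∀ τ ∈ Ψ, Y τ = Y' τ) (v : EuclideanSpace ℝ (Fin d)) :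
    sampleMean X Y Ψ v = sampleMean X' Y' Ψ v := by
  unfold sampleMean thetaHat
  rw [gram_congr X Ψ hX, Finset.sum_congr rfl fun τ hτ => by rw [hX τ hτ, hY τ hτ]]

/-! ### Quantities of the run that a history determines -/

section Agree

variable {x θ a₀} {A : ℕ → Fin K} {Y : ℕ → ℝ} {s t : ℕ} {c : ℕ → Option (ℕ × Fin K)}

theorem indexSets_eq_historySet (h : ∀ τ < t, roundLabel T x A Y s τ = c τ) {r : ℕ} (hr : r ≤ s) :
    indexSets T x A Y t r = historySet c t r := by
  ext τ
  rw [mem_indexSets, historySet, Finset.mem_filter, Finset.mem_range]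
  refine and_congr_right fun hτ => ?_
  rw [← h τ hτ, roundLabel]
  split_ifs with h'
  · simp only [Option.map_some, Option.some.injEq]
    exact ⟨fun h => h.2.1, fun h => ⟨h'.1, h, h'.2.2⟩⟩
  · simp only [Option.map_none, reduceCtorEq, iff_false]
    rintro ⟨h1, rfl, h3⟩
    exact h' ⟨h1, hr, h3⟩

theorem arm_eq_historyArm (h : ∀ τ < t, roundLabel T x A Y s τ = c τ) {r τ : ℕ}
    (hτ : τ ∈ historySet c t r) : A τ = historyArm a₀ c τ := by
  obtain ⟨h1, h2⟩ := Finset.mem_filter.1 hτ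
  obtain ⟨⟨q, a⟩, hqa, -⟩ := Option.map_eq_some_iff.1 h2
  have h3 := h τ (Finset.mem_range.1 h1)
  rw [hqa, roundLabel_eq_some] at h3
  rw [historyArm, hqa]
  exact h3.2.2.2.2

theorem roundWidths_eq_historyWidths (h : ∀ τ < t, roundLabel T x A Y s τ = c τ) {r : ℕ}
    (hr : r ≤ s) : roundWidths T x A Y t r = historyWidths T x a₀ c t r := by
  funext a
  rw [roundWidths, widths, historyWidths, indexSets_eq_historySet h hr, width, width,
    gram_congr _ _ fun τ hτ => by rw [arm_eq_historyArm (a₀ := a₀) h hτ]]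

theorem roundMeans_eq_historyMeans {e : ℕ → Fin K → ℝ}
    (h : ∀ τ < t, roundLabel T x A (rewards x θ A e) s τ = c τ) {r : ℕ} (hr : r ≤ s) :
    roundMeans T x A (rewards x θ A e) t r = historyMeans x θ a₀ e c t r := by
  funext a
  rw [roundMeans, sampleMeans, historyMeans, indexSets_eq_historySet h hr]
  exact sampleMean_congr (fun τ hτ => by rw [arm_eq_historyArm (a₀ := a₀) h hτ])
    (fun τ hτ => by rw [rewards, rewards, arm_eq_historyArm (a₀ := a₀) h hτ]) _

/-- Once the past labels are fixed, the next label is decided by history quantities alone. The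
actual arms and the tie-breaking of the index rule drop out, so no measurability of `A` is needed
for the event. -/
theorem roundLabel_eq_some_iff_exploresArm (hT : 1 ≤ T)
    {ρ : ℕ → ℕ → (Fin K → ℝ) → Finset (Fin K) → Fin K} {e : ℕ → Fin K → ℝ}
    (hA : Follows T x ρ A (rewards x θ A e)) (ht : t ∈ Finset.Icc 1 T)
    (h : ∀ τ < t, roundLabel T x A (rewards x θ A e) s τ = c τ) {r : ℕ} {a : Fin K} :
    roundLabel T x A (rewards x θ A e) s t = some (r, a) ↔ r ≤ s ∧
      ExploresArm T ρ t (historyWidths T x a₀ c t) (historyMeans x θ a₀ e c t) r a := by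
  rw [roundLabel_eq_some]
  simp only [(Finset.mem_Icc.1 ht).1, true_and]
  refine and_congr_right fun hr => ?_
  rw [← exploresArm_congr hT
    (fun q hq => roundWidths_eq_historyWidths (a₀ := a₀) h (hq.trans hr))
    (fun q hq => roundMeans_eq_historyMeans (a₀ := a₀) h (hq.le.trans hr))]
  refine and_congr_right fun hp => ?_
  subst hp
  exact and_congr_right fun he => by rw [(hA t ht).2 he]

end Agree

/-! ### The confidence intervals hold with high probability -/

section Probability

variable {Ω : Type*} {η : ℕ → Fin K → Ω → ℝ} {A : Ω → ℕ → Fin K}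
  {ρ : ℕ → ℕ → (Fin K → ℝ) → Finset (Fin K) → Fin K}

/-- The `σ`-algebra generated by the noise in the rounds of a set. -/
abbrev noiseSigma (η : ℕ → Fin K → Ω → ℝ) (I : Set ℕ) : MeasurableSpace Ω :=
  ⨆ τ ∈ I, MeasurableSpace.comap (fun ω a => η τ a ω) inferInstance

theorem measurable_noiseSigma {I : Set ℕ} {τ : ℕ} (hτ : τ ∈ I) (a : Fin K) :
    Measurable[noiseSigma η I] (η τ a) := by
  have h : Measurable[MeasurableSpace.comap (fun ω a => η τ a ω) inferInstance] (η τ a) :=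
    (measurable_pi_apply a).comp (comap_measurable fun ω a => η τ a ω)
  exact h.mono (le_iSup₂_of_le (f := fun τ (_ : τ ∈ I) =>
    MeasurableSpace.comap (fun ω a => η τ a ω) inferInstance) τ hτ le_rfl) le_rfl

theorem measurable_historyMeans {I : Set ℕ} {c : ℕ → Option (ℕ × Fin K)} {t r : ℕ}
    (h : ∀ τ ∈ historySet c t r, τ ∈ I) (b : Fin K) :
    Measurable[noiseSigma η I] fun ω => historyMeans x θ a₀ (fun τ a => η τ a ω) c t r b := by
  unfold historyMeans
  simp only [sampleMean_eq]
  refine @Finset.measurable_fun_sum _ _ _ _ _ _ (noiseSigma η I) _ _ fun τ hτ => ?_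
  exact ((measurable_noiseSigma (h τ hτ) _).const_add _).mul_const _

theorem measurableSet_lt_abs_historyMeans_sub {I : Set ℕ} {c : ℕ → Option (ℕ × Fin K)} {t r : ℕ}
    (h : ∀ τ ∈ historySet c t r, τ ∈ I) (b : Fin K) (u v : ℝ) :
    MeasurableSet[noiseSigma η I]
      {ω | u < |historyMeans x θ a₀ (fun τ a => η τ a ω) c t r b - v|} := by
  have hm := measurable_historyMeans (η := η) x θ a₀ h b
  let _ : MeasurableSpace Ω := noiseSigma η I
  exact measurableSet_lt measurable_const (hm.sub_const v).abs

/-- The rounds that belong to a phase before `s` in the history `c`. -/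
def earlierRounds (c : ℕ → Option (ℕ × Fin K)) (s : ℕ) : Set ℕ :=
  {τ | ∃ r < s, (c τ).map Prod.fst = some r}

/-- Induction over rounds: along a fixed past, a label of phase `r ≤ s` reads only means of phases
`q < r`, and these use noise from rounds recorded in phases before `s`. -/
theorem measurableSet_history (a₀ : Fin K) (hT : 1 ≤ T)
    (hA : ∀ ω, Follows T x ρ (A ω) (rewards x θ (A ω) fun τ a => η τ a ω))
    (c : ℕ → Option (ℕ × Fin K)) (s : ℕ) {n : ℕ} (hn : n ≤ T + 1) :
    MeasurableSet[noiseSigma η (earlierRounds c s)]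
      {ω | ∀ τ < n, roundLabel T x (A ω) (rewards x θ (A ω) fun τ a => η τ a ω) s τ = c τ} := by
  induction n with
  | zero => simp
  | succ n ih =>
    specialize ih (by omega)
    set E := {ω | ∀ τ < n, roundLabel T x (A ω) (rewards x θ (A ω) fun τ a => η τ a ω) s τ = c τ}
      with hE
    have hsplit : {ω | ∀ τ < n + 1,
        roundLabel T x (A ω) (rewards x θ (A ω) fun τ a => η τ a ω) s τ = c τ} =
        E ∩ {ω | roundLabel T x (A ω) (rewards x θ (A ω) fun τ a => η τ a ω) s n = c n} := by
      ext ω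
      simp only [hE, Set.mem_ofPred_eq, Set.mem_inter_iff, Nat.lt_succ_iff_lt_or_eq, or_imp,
        forall_and, forall_eq]
    rw [hsplit]
    rcases Nat.eq_zero_or_pos n with rfl | hn0
    -- Round `0` always carries the label `none`, so this event is trivial.
    · refine ih.inter ?_
      simp [roundLabel]
    have ht : n ∈ Finset.Icc 1 T := Finset.mem_Icc.2 ⟨hn0, by omega⟩
    set D : ℕ → Fin K → Set Ω := fun r a => {ω | ExploresArm T ρ n (historyWidths T x a₀ c n)
      (historyMeans x θ a₀ (fun τ a => η τ a ω) c n) r a} with hD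
    have hDm : ∀ r ≤ s, ∀ a, MeasurableSet[noiseSigma η (earlierRounds c s)] (D r a) :=
      fun r hr a => @measurableSet_exploresArm _ _ (noiseSigma η (earlierRounds c s)) _ _ _ hT _ _ _
        (fun q hq b => measurable_historyMeans x θ a₀
          (I := earlierRounds c s) (fun τ hτ => ⟨q, hq.trans_le hr, (Finset.mem_filter.1 hτ).2⟩) b) a
    have hiff : ∀ ω ∈ E, ∀ r a,
        roundLabel T x (A ω) (rewards x θ (A ω) fun τ a => η τ a ω) s n = some (r, a) ↔
          r ≤ s ∧ ω ∈ D r a := fun ω hω r a =>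
      roundLabel_eq_some_iff_exploresArm hT (hA ω) ht hω
    rcases hc : c n with _ | ⟨r, a⟩
    · have : E ∩ {ω | roundLabel T x (A ω) (rewards x θ (A ω) fun τ a => η τ a ω) s n = none} =
          E ∩ ⋂ r ∈ Finset.range (s + 1), ⋂ a, (D r a)ᶜ := by
        ext ω
        refine and_congr_right fun hω => ?_
        simp only [Set.mem_ofPred_eq, Set.mem_iInter, Set.mem_compl_iff, Finset.mem_range,
          Option.eq_none_iff_forall_ne_some, Prod.forall, Ne, hiff ω hω, not_and, Nat.lt_succ_iff]
        exact ⟨fun h r hr a => h r a hr, fun h r a hr => h r hr a⟩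
      rw [this]
      exact ih.inter (Finset.measurableSet_biInter _ fun r hr => MeasurableSet.iInter fun a =>
        (hDm r (Nat.lt_succ_iff.1 (Finset.mem_range.1 hr)) a).compl)
    · have : E ∩ {ω | roundLabel T x (A ω) (rewards x θ (A ω) fun τ a => η τ a ω) s n =
          some (r, a)} = E ∩ {ω | r ≤ s ∧ ω ∈ D r a} := by
        ext ω
        exact and_congr_right fun hω => hiff ω hω r a
      rw [this]
      refine ih.inter ?_
      by_cases hr : r ≤ s
      · simp only [hr, true_and]
        exact hDm r hr a
      · simp only [hr, false_and]
        exact MeasurableSet.const _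

/-! ### From fixed histories to the random run -/

variable {x θ} [mΩ : MeasurableSpace Ω] {P : Measure Ω} [IsProbabilityMeasure P] {R : ℝ≥0}

/-- A bound on conditional probabilities along the members of a countable partition into events
independent of the bounding events. -/
theorem measure_le_of_countable_partition {ι : Type*} [Countable ι] {B : Set Ω} {E F : ι → Set Ω}
    {p : ENNReal} (hE : ∀ i, MeasurableSet (E i)) (hdisj : Pairwise (Function.onFun Disjoint E))
    (hcover : ∀ ω, ∃ i, ω ∈ E i) (hB : ∀ i, ∀ ω ∈ E i, ω ∈ B → ω ∈ F i)
    (hind : ∀ i, P (E i ∩ F i) = P (E i) * P (F i)) (hF : ∀ i, P (F i) ≤ p) : P B ≤ p := by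
  have hsub : B ⊆ ⋃ i, E i ∩ F i := fun ω hω => by
    obtain ⟨i, hi⟩ := hcover ω
    exact Set.mem_iUnion.2 ⟨i, hi, hB i ω hi hω⟩
  calc P B ≤ ∑' i, P (E i ∩ F i) := (measure_mono hsub).trans (measure_iUnion_le _)
    _ ≤ ∑' i, P (E i) * p := ENNReal.tsum_le_tsum fun i => by
        rw [hind i]
        gcongr
        exact hF i
    _ = P (⋃ i, E i) * p := by rw [ENNReal.tsum_mul_right, measure_iUnion hdisj hE]
    _ ≤ 1 * p := by gcongr; exact prob_le_one
    _ = p := one_mul p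

/-- The partition is by histories up to phase `s` of the rounds before `t`. On each cell the error
is that of a deterministic design, whose noise is independent of the cell. -/
theorem measure_not_confident_arm_le (hT : 1 ≤ T) (hθ : ‖θ‖ ≤ 1) (hR : R ≤ 1 / 2)
    (hηm : ∀ t a, Measurable (η t a)) (hη : ∀ t a, HasSubgaussianMGF (η t a) (R ^ 2) P)
    (hind : iIndepFun (fun t ω a => η t a ω) P)
    (hA : ∀ ω, Follows T x ρ (A ω) (rewards x θ (A ω) fun τ a => η τ a ω))
    {t : ℕ} (ht : t ≤ T) (s : ℕ) (a : Fin K) :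
    P {ω | roundWidths T x (A ω) (rewards x θ (A ω) fun τ a => η τ a ω) t s a <
        |roundMeans T x (A ω) (rewards x θ (A ω) fun τ a => η τ a ω) t s a - inner ℝ θ (x t a)|} ≤
      ENNReal.ofReal (2 * Real.exp (2 - 2 * alpha T K t ^ 2)) := by
  -- Recording only the rounds before `t` keeps the set of histories countable; later rounds get the
  -- irrelevant label `none`.
  set ext : (Fin t → Option (ℕ × Fin K)) → ℕ → Option (ℕ × Fin K) :=
    fun c τ => if h : τ < t then c ⟨τ, h⟩ else none with hext
  set L : Ω → ℕ → Option (ℕ × Fin K) := fun ω =>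
    roundLabel T x (A ω) (rewards x θ (A ω) fun τ a => η τ a ω) s with hL
  have hle : ∀ I, noiseSigma η I ≤ mΩ := fun I => iSup₂_le fun τ _ =>
    (measurable_pi_lambda _ fun a => hηm τ a).comap_le
  have hmem : ∀ c ω, (∀ τ < t, L ω τ = ext c τ) ↔ c = fun i : Fin t => L ω i := by
    intro c ω
    constructor
    · intro h
      funext i
      rw [h i i.2]
      simp [hext]
    · rintro rfl τ hτ
      simp [hext, hτ]
  -- The arm `a` doubles as the default for unrecorded rounds; these lie in no history set, so the
  -- choice is immaterial.
  have hmeas := fun c : Fin t → Option (ℕ × Fin K) =>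
    measurableSet_history x θ a hT hA (ext c) s (n := t) (by omega)
  refine measure_le_of_countable_partition (E := fun c => {ω | ∀ τ < t, L ω τ = ext c τ})
    (F := fun c => {ω | historyWidths T x a (ext c) t s a <
      |historyMeans x θ a (fun τ a => η τ a ω) (ext c) t s a - inner ℝ θ (x t a)|})
    (fun c => hle _ _ (hmeas c)) ?_ ?_ ?_ ?_ ?_
  · intro c c' hcc
    refine Set.disjoint_left.2 fun ω h h' => hcc ?_
    exact ((hmem c ω).1 h).trans ((hmem c' ω).1 h').symm
  · exact fun ω => ⟨fun i => L ω i, (hmem _ ω).2 rfl⟩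
  · intro c ω hω hB
    have h1 := roundWidths_eq_historyWidths (a₀ := a) (T := T) hω le_rfl
    have h2 := roundMeans_eq_historyMeans (a₀ := a) hω le_rfl
    simp only [Set.mem_ofPred_eq] at hB ⊢
    rwa [h1, h2] at hB
  · intro c
    -- A round has a single phase label, so rounds of phase `s` are not rounds of an earlier phase.
    have hdis : Disjoint (earlierRounds (ext c) s) (historySet (ext c) t s : Set ℕ) := by
      refine Set.disjoint_left.2 ?_
      rintro τ ⟨r, hr, h1⟩ h2
      have h3 := (Finset.mem_filter.1 (Finset.mem_coe.1 h2)).2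
      rw [h1, Option.some.injEq] at h3
      omega
    have hI := indep_iSup_of_disjoint
      (fun τ => (measurable_pi_lambda _ fun a => hηm τ a).comap_le) hind hdis
    refine (Indep_iff _ _ _).1 hI _ _ (hmeas c) ?_
    exact measurableSet_lt_abs_historyMeans_sub x θ a (fun τ hτ => Finset.mem_coe.2 hτ) _ _ _
  · exact fun c => measure_width_lt_error_le hR hη hind hθ T t _ _ _ _

/-- Union bound over phases and arms: the factor `K` in the logarithm of `alpha` cancels the number
of arms, and the factor `T` leaves a probability that can be summed over the rounds. -/
theorem measure_not_confident_le (hT : 1 ≤ T) (hK : 1 ≤ K) (hθ : ‖θ‖ ≤ 1) (hR : R ≤ 1 / 2)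
    (hηm : ∀ t a, Measurable (η t a)) (hη : ∀ t a, HasSubgaussianMGF (η t a) (R ^ 2) P)
    (hind : iIndepFun (fun t ω a => η t a ω) P)
    (hA : ∀ ω, Follows T x ρ (A ω) (rewards x θ (A ω) fun τ a => η τ a ω))
    {t : ℕ} (ht : t ∈ Finset.Icc 1 T) :
    P {ω | ¬ Confident T x (A ω) (rewards x θ (A ω) fun τ a => η τ a ω) θ t} ≤
      ENNReal.ofReal (4 * maxPhase T / T) := by
  obtain ⟨ht1, htT⟩ := Finset.mem_Icc.1 ht
  have hT0 : (1 : ℝ) ≤ T := by exact_mod_cast hT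
  have hK0 : (1 : ℝ) ≤ K := by exact_mod_cast hK
  have ht0 : (1 : ℝ) ≤ t := by exact_mod_cast ht1
  have hsub : {ω | ¬ Confident T x (A ω) (rewards x θ (A ω) fun τ a => η τ a ω) θ t} ⊆
      ⋃ s ∈ Finset.Icc 1 (maxPhase T), ⋃ a ∈ (Finset.univ : Finset (Fin K)),
        {ω | roundWidths T x (A ω) (rewards x θ (A ω) fun τ a => η τ a ω) t s a <
          |roundMeans T x (A ω) (rewards x θ (A ω) fun τ a => η τ a ω) t s a -
            inner ℝ θ (x t a)|} := by
    intro ω hω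
    simp only [Set.mem_ofPred_eq, Confident] at hω
    push Not at hω
    obtain ⟨s, hs, a, ha⟩ := hω
    exact Set.mem_iUnion₂.2 ⟨s, hs, Set.mem_iUnion₂.2 ⟨a, Finset.mem_univ _, ha⟩⟩
  refine (measure_mono hsub).trans ((measure_biUnion_finset_le _ _).trans ?_)
  refine (Finset.sum_le_sum fun s _ => (measure_biUnion_finset_le _ _).trans
    (Finset.sum_le_sum fun a _ =>
      measure_not_confident_arm_le hT hθ hR hηm hη hind hA htT s a)).trans ?_
  simp only [Finset.sum_const, Nat.card_Icc, add_tsub_cancel_right, Finset.card_univ,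
    Fintype.card_fin, ← ENNReal.ofReal_nsmul]
  refine ENNReal.ofReal_le_ofReal ?_
  rw [sub_eq_add_neg, Real.exp_add, exp_alpha hT hK ht1]
  simp only [nsmul_eq_mul]
  have he : Real.exp 2 ≤ 8 := by
    have h := Real.exp_one_lt_d9
    have h2 : Real.exp 2 = Real.exp 1 * Real.exp 1 := by rw [← Real.exp_add]; norm_num
    rw [h2]
    nlinarith [Real.exp_pos 1]
  have hinv : (4 * (T : ℝ) * K * t ^ 2)⁻¹ ≤ (4 * (T : ℝ) * K)⁻¹ :=
    inv_anti₀ (by positivity) (le_mul_of_one_le_right (by positivity) (one_le_pow₀ ht0))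
  calc (maxPhase T : ℝ) * (K * (2 * (Real.exp 2 * (4 * (T : ℝ) * K * t ^ 2)⁻¹)))
      ≤ (maxPhase T : ℝ) * (K * (2 * (8 * (4 * (T : ℝ) * K)⁻¹))) := by gcongr
    _ = 4 * maxPhase T / T := by field_simp; ring

end Probability

end History

/-! ### The regret bound -/

section Regret

variable {d K T : ℕ}

theorem maxPhase_le (hT : 1 ≤ T) : (maxPhase T : ℝ) ≤ 1 + Real.log T := by
  have h0 : 0 ≤ Real.log T := Real.log_nonneg (by exact_mod_cast hT)
  have h1 := (Nat.ceil_lt_add_one h0).le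
  rw [maxPhase, Nat.cast_max]
  refine max_le ?_ ?_
  · push_cast; linarith
  · linarith

/-- For `K ≥ 2` the logarithm `M` is at least `log 2`, so additive constants can be absorbed into
multiples of `M`. For `K = T = 1` the right-hand side would vanish. -/
theorem regret_bound_le (hd : 1 ≤ d) (hT : 1 ≤ T) (hK : 2 ≤ K) :
    4 * (maxPhase T : ℝ) + (3 * √(T : ℝ) +
      8 * (alpha T K T * √(T * (2 * (maxPhase T * (d * Real.log (1 + T))))))) ≤
      100 * √(d * T * Real.log (K * T) ^ 3) := by
  have hT1 : (1 : ℝ) ≤ T := by exact_mod_cast hT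
  have hK2 : (2 : ℝ) ≤ K := by exact_mod_cast hK
  have hd1 : (1 : ℝ) ≤ d := by exact_mod_cast hd
  have hKT : (2 : ℝ) ≤ K * T := by nlinarith
  have hl2 := Real.log_two_gt_d9
  set M := Real.log (K * T) with hM
  have hML : Real.log 2 ≤ M := Real.log_le_log two_pos hKT
  have hM0 : 0.69 ≤ M := by linarith
  have hTM : Real.log T ≤ M := Real.log_le_log (by linarith) (by nlinarith)
  have hS : (maxPhase T : ℝ) ≤ 5 / 2 * M := by linarith [maxPhase_le hT]
  have hlogT : Real.log (1 + T) ≤ 2 * M := by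
    calc Real.log (1 + T) ≤ Real.log (2 * T) := Real.log_le_log (by linarith) (by linarith)
      _ = Real.log 2 + Real.log T := Real.log_mul two_ne_zero (by linarith)
      _ ≤ 2 * M := by linarith
  have hα : alpha T K T ≤ √(5 / 2 * M) := by
    refine Real.sqrt_le_sqrt ?_
    rw [alpha_arg]
    have h1 : 4 * (T : ℝ) * K * T ^ 2 ≤ ((K : ℝ) * T) ^ 5 := by
      have h2 : (T : ℝ) ≤ K * T := by nlinarith
      have h3 : (T : ℝ) ^ 2 ≤ ((K : ℝ) * T) ^ 2 := pow_le_pow_left₀ (by linarith) h2 2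
      have h4 : (4 : ℝ) ≤ ((K : ℝ) * T) ^ 2 := by nlinarith
      calc 4 * (T : ℝ) * K * T ^ 2 = 4 * ((K : ℝ) * T) * T ^ 2 := by ring
        _ ≤ ((K : ℝ) * T) ^ 2 * (K * T) * (K * T) ^ 2 := by gcongr
        _ = ((K : ℝ) * T) ^ 5 := by ring
    have h5 := Real.log_le_log (by positivity) h1
    rw [Real.log_pow] at h5
    push_cast at h5
    linarith
  have hdT : (1 : ℝ) ≤ d * T := by nlinarith
  have hM3 : 0 ≤ M ^ 3 := by positivity
  have hTB : √(T : ℝ) ≤ 2 * √(d * T * M ^ 3) := by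
    rw [Real.sqrt_le_left (by positivity), mul_pow, Real.sq_sqrt (by positivity)]
    have h1 : (1 : ℝ) / 4 ≤ M ^ 3 := by
      calc (1 : ℝ) / 4 ≤ 0.69 ^ 3 := by norm_num
        _ ≤ M ^ 3 := pow_le_pow_left₀ (by norm_num) hM0 3
    have h2 : (T : ℝ) ≤ d * T := by nlinarith
    nlinarith
  have hMB : M ≤ 2 * √(d * T * M ^ 3) := by
    rw [← Real.sqrt_sq (show 0 ≤ M by linarith), Real.sqrt_le_left (by positivity), mul_pow,
      Real.sq_sqrt (by positivity), Real.sqrt_sq (by linarith)]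
    have h2 : M ^ 2 ≤ 4 * M ^ 3 := by nlinarith [sq_nonneg M]
    nlinarith
  have hmain : alpha T K T * √(T * (2 * (maxPhase T * (d * Real.log (1 + T))))) ≤
      5 * √(d * T * M ^ 3) := by
    have h1 : √(T * (2 * (maxPhase T * (d * Real.log (1 + T))))) ≤ √(10 * (d * T * M ^ 2)) := by
      refine Real.sqrt_le_sqrt ?_
      calc T * (2 * (maxPhase T * (d * Real.log (1 + T))))
          ≤ T * (2 * (5 / 2 * M * (d * (2 * M)))) := by
            have := Real.log_nonneg (show (1 : ℝ) ≤ 1 + T by linarith)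
            gcongr
        _ = 10 * (d * T * M ^ 2) := by ring
    calc alpha T K T * √(T * (2 * (maxPhase T * (d * Real.log (1 + T)))))
        ≤ √(5 / 2 * M) * √(10 * (d * T * M ^ 2)) :=
          mul_le_mul hα h1 (Real.sqrt_nonneg _) (Real.sqrt_nonneg _)
      _ = √(5 ^ 2 * (d * T * M ^ 3)) := by
          rw [← Real.sqrt_mul (by linarith)]
          congr 1
          ring
      _ = 5 * √(d * T * M ^ 3) := by
          rw [Real.sqrt_mul (by norm_num), Real.sqrt_sq (by norm_num)]
  -- The three terms contribute `20 + 6 + 40 = 66` multiples of the root.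
  linarith

theorem integral_sum_gap_le {Ω : Type*} [MeasurableSpace Ω] {P : Measure Ω} [IsProbabilityMeasure P]
    {x : ℕ → Fin K → EuclideanSpace ℝ (Fin d)} {θ : EuclideanSpace ℝ (Fin d)}
    {A : ℕ → Ω → Fin K} {B : ℕ → Set Ω} {p b : ℝ} (hK : 1 ≤ K) (hp : 0 ≤ p)
    (hB : ∀ t ∈ Finset.Icc 1 T, P (B t) ≤ ENNReal.ofReal p)
    (h : ∀ ω, ∀ f : ℕ → ℝ, (∀ t ∈ Finset.Icc 1 T, 0 ≤ f t) →
      (∀ t ∈ Finset.Icc 1 T, ω ∈ B t → 1 ≤ f t) →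
      ∑ t ∈ Finset.Icc 1 T, gap x θ t (A t ω) ≤ ∑ t ∈ Finset.Icc 1 T, f t + b) :
    ∫ ω, ∑ t ∈ Finset.Icc 1 T, gap x θ t (A t ω) ∂P ≤ T * p + b := by
  have hint : ∀ t, Integrable ((toMeasurable P (B t)).indicator fun _ => (1 : ℝ)) P := fun t =>
    -- The failure events need not be known to be measurable: their measurable hulls have the same
    -- probability and still dominate.
    (integrable_const 1).indicator (measurableSet_toMeasurable _ _)
  have hint' := integrable_finsetSum (Finset.Icc 1 T) fun t _ => hint t
  calc ∫ ω, ∑ t ∈ Finset.Icc 1 T, gap x θ t (A t ω) ∂P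
      ≤ ∫ ω, (∑ t ∈ Finset.Icc 1 T,
          (toMeasurable P (B t)).indicator (fun _ => (1 : ℝ)) ω + b) ∂P := by
        refine integral_mono_of_nonneg (Filter.Eventually.of_forall fun ω =>
          Finset.sum_nonneg fun t _ => ?_) (hint'.add (integrable_const b))
          (Filter.Eventually.of_forall fun ω => h ω _ (fun t _ =>
            Set.indicator_nonneg (fun _ _ => zero_le_one) _) fun t _ hω => ?_)
        · obtain ⟨best, hbest, hgap⟩ := exists_gap_eq (x := x) hK θ t
          rw [hgap]
          exact sub_nonneg.2 (hbest _)
        · rw [Set.indicator_of_mem (subset_toMeasurable _ _ hω)]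
    _ = ∑ t ∈ Finset.Icc 1 T, P.real (B t) + b := by
        rw [integral_add hint' (integrable_const b), integral_finsetSum _ fun t _ => hint t]
        congr 1
        · refine Finset.sum_congr rfl fun t _ => ?_
          rw [integral_indicator_const _ (measurableSet_toMeasurable _ _), Measure.real,
            measure_toMeasurable]
          simp [Measure.real]
        · simp
    _ ≤ T * p + b := by
        gcongr
        refine (Finset.sum_le_card_nsmul _ _ p fun t ht => ?_).trans_eq (by simp)
        exact ENNReal.toReal_le_of_le_ofReal hp (hB t ht)

end Regret

end SupLinIMED

end

theorem theorem4 :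
    ∃ C : ℝ, 0 < C ∧
      ∀ (d K T : ℕ), 1 ≤ d → 1 ≤ K → 1 ≤ T →
      ∀ (x : ℕ → Fin K → EuclideanSpace ℝ (Fin d)) (θ : EuclideanSpace ℝ (Fin d)),
      (∀ t ∈ Finset.Icc 1 T, ∀ a, ‖x t a‖ ≤ 1) →
      ‖θ‖ ≤ 1 →
      (∀ t ∈ Finset.Icc 1 T, ∀ b, SupLinIMED.gap x θ t b ≤ 1) →
      ∀ (Ω : Type*) [MeasurableSpace Ω] (P : Measure Ω) [IsProbabilityMeasure P]
        (R : ℝ≥0) (η : ℕ → Fin K → Ω → ℝ),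
      R ≤ 1 / 2 →
      (∀ t a, Measurable (η t a)) →
      (∀ t a, HasSubgaussianMGF (η t a) (R ^ 2) P) →
      iIndepFun (fun t ω a => η t a ω) P →
      ∀ (ρ : ℕ → ℕ → (Fin K → ℝ) → Finset (Fin K) → Fin K),
      (∀ t s w E, E.Nonempty → ρ t s w E ∈ E) →
      ∀ (A : ℕ → Ω → Fin K),
      (∀ t, Measurable (A t)) →
      (∀ ω, SupLinIMED.Follows T x ρ (fun t => A t ω)
        (fun t => inner ℝ θ (x t (A t ω)) + η t (A t ω) ω)) →
      ∫ ω, ∑ t ∈ Finset.Icc 1 T, SupLinIMED.gap x θ t (A t ω) ∂P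
        ≤ C * √(d * T * Real.log (K * T) ^ 3) := by
  refine ⟨100, by norm_num, ?_⟩
  intro d K T hd hK hT x θ hx hθ hgap Ω _ P _ R η hR hηm hη hind ρ hρ A _ hA
  have hT0 : (0 : ℝ) < T := by exact_mod_cast hT
  rcases hK.eq_or_lt with rfl | hK2
  -- With a single arm there is no regret, which covers the case where the logarithm may be zero.
  · have h0 : ∀ t b, SupLinIMED.gap x θ t b = 0 := fun t b => by
      obtain ⟨best, -, h⟩ := SupLinIMED.exists_gap_eq (x := x) hK θ t
      rw [h, Subsingleton.elim best b, sub_self]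
    simp only [h0, Finset.sum_const_zero, integral_zero]
    positivity
  · refine (SupLinIMED.integral_sum_gap_le (p := 4 * SupLinIMED.maxPhase T / T) hK (by positivity)
      (fun t ht => SupLinIMED.measure_not_confident_le (A := fun ω t => A t ω)
        hT hK hθ hR hηm hη hind hA ht)
      fun ω f hf0 hf => SupLinIMED.sum_gap_le hK hT hρ (hA ω) hx hgap hf0 hf).trans ?_
    rw [mul_div_cancel₀ _ hT0.ne']
    exact SupLinIMED.regret_bound_le hd hT hK2
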